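/- Let $M$ be a connected smooth manifold of dimension $n$, and let $FM\to M$ be its frame bundle, with its right action of $Gl(n,\mathbb R)$. For a local diffeomorphism $\varphi$ between $n$-manifolds, let $F\varphi$ be the induced map of frames, and for $v\in\mathbb R^n$ let $\tau_v$ be the translation of $\mathbb R^n$ by $v$. The second-order non-holonomic groupoid $\tilde J^1(FM)\rightrightarrows M$ consists of the classes $j^1_{x,y}\Psi$ of the $1$-jets $j^1_{X,Y}\Psi$ of local $Gl(n,\mathbb R)$-equivariant diffeomorphisms $\Psi$ of $FM$, where $X$ is a frame at $x$ and $Y=\Psi(X)$ is a frame at $y$, modulo $j^1_{X,Y}\Psi\sim j^1_{X g,Y g}\Psi$ for $g\in Gl(n,\mathbb R)$; its source and target maps are $j^1_{x,y}\Psi\mapsto x$ and $j^1_{x,y}\Psi\mapsto y$, and jets are composed by composing representatives. A local coordinate system $(x^i)$ on an open set $U\subseteq M$ induces coordinates $(x^i,x^i_j)$ on $FU$, where $x^i_j(X)$ is the $i$-th component of the $j$-th vector of the frame $X$. Using such coordinates $(x^i)$ on $U$ and $(y^j)$ on $V$, one has the coordinates $((x^i,y^j,y^j_i),y^j_{,i},y^j_{i,k})$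 on the set of arrows of $\tilde J^1(FM)$ with source in $U$ and target in $V$: if $e_{1x}$ denotes the frame at $x$ with $x^i_j(e_{1x})=\delta^i_j$, the last three groups of coordinates of $j^1_{x,y}\Psi$ are $$y^j_i=y^j_i(\Psi(e_{1x})),\qquad y^j_{,i}=\frac{\partial (y^j\circ\Psi)}{\partial x^i}\Big|_{e_{1x}},\qquad y^j_{i,k}=\frac{\partial (y^j_i\circ\Psi)}{\partial x^k}\Big|_{e_{1x}}.$$ Let $\overline G^2(n)$ be the isotropy group at $0$ of $\tilde J^1(F\mathbb R^n)$, a Lie group. Submanifolds, Lie subgroups and Lie subgroupoids are understood to be embedded. Let $\Gamma$ be a reduced Lie subgroupoid of $\tilde J^1(FM)$, that is, a transitive Lie subgroupoid with base $M$. We say that $\Gamma$ is integrable if there is a Lie subgroup $\overline G$ of $\overline G^2(n)$ such that around each point of $M$ there is a chart $\psi_U:U\to\overline U\subseteq\mathbb R^n$ for which the map $$j^1_{x,y}\Psi\mapsto\Big(\psi_U(x),\ \psi_U(y),\ j^1_{0,0}\big(F(\tau_{-\psi_U(y)}\circ\psi_U)\circ\Psi\circ F(\psi_U^{-1}\circ\tau_{\psi_U(x)})\big)\Big)$$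 is an isomorphism of Lie groupoids from the restriction of $\Gamma$ to $U$ (the arrows with source and target in $U$) onto the trivial Lie groupoid $\overline U\times\overline U\times\overline G\rightrightarrows\overline U$. Then $\Gamma$ is integrable if and only if for each point of $M$ there is a local coordinate system $(x^i)$ on an open neighbourhood $U$ of this point such that the local section $$\overline{\mathcal P}(x^i,y^j)=\big((x^i,y^j,\delta^j_i),\delta^j_i,0\big)$$ of $\tilde J^1(FM)$ over $U\times U$, written in the coordinates that $(x^i)$ induces for source and target, takes values in $\Gamma$. -/

import Mathlib

open scoped Manifold ContDiff

namespace NonHolonomic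

open CategoryTheory Set Topology

/-- The model space `ℝⁿ`. -/
abbrev Rn (n : ℕ) := EuclideanSpace ℝ (Fin n)

set_option linter.unusedSectionVars false

section Frames

variable {n : ℕ} {M N P : Type*}
  [TopologicalSpace M] [ChartedSpace (Rn n) M]
  [TopologicalSpace N] [ChartedSpace (Rn n) N]
  [TopologicalSpace P] [ChartedSpace (Rn n) P]

/-- A point of the frame bundle `FM`: a point `x` of `M` together with a linear frame at `x`, seen
as a linear isomorphism from `ℝⁿ` onto `T_x M`. -/
structure Frame (n : ℕ) (M : Type*) [TopologicalSpace M] [ChartedSpace (Rn n) M] where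
  base : M
  lin : Rn n →L[ℝ] TangentSpace 𝓘(ℝ, Rn n) base
  isInvertible : lin.IsInvertible

/-- The right action of `Gl(n, ℝ)` on `FM`. -/
noncomputable def Frame.act (X : Frame n M) (g : Rn n ≃L[ℝ] Rn n) : Frame n M :=
  ⟨X.base, X.lin ∘L (g : Rn n →L[ℝ] Rn n),
    X.isInvertible.comp ContinuousLinearMap.isInvertible_equiv⟩

open scoped Classical in
/-- The frame at `x` given by a linear isomorphism `T` (an irrelevant frame at `x` if `T` is not
invertible). -/
noncomputable def Frame.mkOf (x : M) (T : Rn n →L[ℝ] TangentSpace 𝓘(ℝ, Rn n) x) : Frame n M :=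
  if h : T.IsInvertible then ⟨x, T, h⟩
  else ⟨x, (ContinuousLinearMap.id ℝ (Rn n) : Rn n →L[ℝ] Rn n),
    ⟨ContinuousLinearEquiv.refl ℝ (Rn n), rfl⟩⟩

@[simp] theorem Frame.mkOf_base (x : M) (T : Rn n →L[ℝ] TangentSpace 𝓘(ℝ, Rn n) x) :
    (Frame.mkOf x T).base = x := by
  unfold Frame.mkOf; split_ifs <;> rfl

theorem Frame.mkOf_eq {x : M} {T : Rn n →L[ℝ] TangentSpace 𝓘(ℝ, Rn n) x}
    (h : T.IsInvertible) : Frame.mkOf x T = ⟨x, T, h⟩ := dif_pos h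

/-- The space of the coordinates `(xⁱ, xⁱⱼ)` of frames. -/
abbrev FrameCoord (n : ℕ) := Rn n × (Rn n →L[ℝ] Rn n)

/-- The space of the coordinates `(yʲᵢ, yʲ,ᵢ, yʲᵢ,ₖ)` of jets. -/
abbrev JetCoord (n : ℕ) :=
  (Rn n →L[ℝ] Rn n) × (Rn n →L[ℝ] Rn n) × (Rn n →L[ℝ] Rn n →L[ℝ] Rn n)

/-- The coordinates `(xⁱ, xⁱⱼ)` on `FM` induced by a local coordinate system `c` on `M`. -/
noncomputable def Frame.coord (c : OpenPartialHomeomorph M (Rn n)) (X : Frame n M) :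
    FrameCoord n :=
  (c X.base, (mfderiv 𝓘(ℝ, Rn n) 𝓘(ℝ, Rn n) c X.base : _ →L[ℝ] Rn n) ∘L X.lin)

/-- The frame with given coordinates `(xⁱ, xⁱⱼ)`: the inverse of `Frame.coord c`. -/
noncomputable def Frame.ofCoord (c : OpenPartialHomeomorph M (Rn n)) (p : FrameCoord n) :
    Frame n M :=
  Frame.mkOf (c.symm p.1)
    ((mfderiv 𝓘(ℝ, Rn n) 𝓘(ℝ, Rn n) c.symm p.1 : Rn n →L[ℝ] _) ∘L p.2)

/-- The frame `(e₁)ₓ` at `x` whose coordinates are `xⁱⱼ = δⁱⱼ` in the coordinate system `c`. -/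
noncomputable def Frame.std (c : OpenPartialHomeomorph M (Rn n)) (x : M) : Frame n M :=
  Frame.mkOf x (mfderiv 𝓘(ℝ, Rn n) 𝓘(ℝ, Rn n) c x : _ →L[ℝ] Rn n).inverse

/-- `c` is a local coordinate system (a smooth chart) of `M`; its domain is `c.source`. -/
abbrev IsCoordSystem (c : OpenPartialHomeomorph M (Rn n)) : Prop :=
  c ∈ IsManifold.maximalAtlas 𝓘(ℝ, Rn n) ∞ M

/-- The homeomorphism `φ` between open sets is a (smooth) diffeomorphism between them. -/
structure IsLocalDiffeo (φ : OpenPartialHomeomorph M N) : Prop where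
  smooth : ContMDiffOn 𝓘(ℝ, Rn n) 𝓘(ℝ, Rn n) ∞ φ φ.source
  smooth_symm : ContMDiffOn 𝓘(ℝ, Rn n) 𝓘(ℝ, Rn n) ∞ φ.symm φ.target

theorem IsLocalDiffeo.symm {φ : OpenPartialHomeomorph M N} (h : IsLocalDiffeo (n := n) φ) :
    IsLocalDiffeo (n := n) φ.symm := ⟨h.smooth_symm, h.smooth⟩

theorem IsLocalDiffeo.trans {φ : OpenPartialHomeomorph M N} {χ : OpenPartialHomeomorph N P}
    (h : IsLocalDiffeo (n := n) φ) (h' : IsLocalDiffeo (n := n) χ) :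
    IsLocalDiffeo (n := n) (φ.trans χ) := by
  constructor
  · exact h'.smooth.comp (h.smooth.mono (fun x hx => hx.1)) (fun x hx => hx.2)
  · exact h.smooth_symm.comp (h'.smooth_symm.mono (fun x hx => hx.1)) (fun x hx => hx.2)

theorem IsLocalDiffeo.refl : IsLocalDiffeo (n := n) (OpenPartialHomeomorph.refl M) :=
  ⟨contMDiff_id.contMDiffOn, contMDiff_id.contMDiffOn⟩

theorem IsLocalDiffeo.mdifferentiable {φ : OpenPartialHomeomorph M N}
    (h : IsLocalDiffeo (n := n) φ) : φ.MDifferentiable 𝓘(ℝ, Rn n) 𝓘(ℝ, Rn n) :=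
  ⟨h.smooth.mdifferentiableOn (by simp), h.smooth_symm.mdifferentiableOn (by simp)⟩

theorem IsCoordSystem.isLocalDiffeo [IsManifold 𝓘(ℝ, Rn n) ∞ M]
    {c : OpenPartialHomeomorph M (Rn n)} (h : IsCoordSystem c) : IsLocalDiffeo (n := n) c :=
  ⟨contMDiffOn_of_mem_maximalAtlas h, contMDiffOn_symm_of_mem_maximalAtlas h⟩

theorem IsLocalDiffeo.isInvertible {φ : OpenPartialHomeomorph M N}
    (h : IsLocalDiffeo (n := n) φ) {x : M} (hx : x ∈ φ.source) :
    (mfderiv 𝓘(ℝ, Rn n) 𝓘(ℝ, Rn n) φ x).IsInvertible :=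
  ⟨h.mdifferentiable.mfderiv hx, rfl⟩

theorem Frame.base_ofCoord (c : OpenPartialHomeomorph M (Rn n)) (p : FrameCoord n) :
    (Frame.ofCoord c p).base = c.symm p.1 := Frame.mkOf_base _ _

theorem Frame.coord_snd_isInvertible {c : OpenPartialHomeomorph M (Rn n)}
    (h : IsLocalDiffeo (n := n) c) {X : Frame n M} (hX : X.base ∈ c.source) :
    (X.coord c).2.IsInvertible :=
  (h.isInvertible hX).comp X.isInvertible

theorem Frame.ofCoord_eq {c : OpenPartialHomeomorph M (Rn n)} (h : IsLocalDiffeo (n := n) c)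
    {p : FrameCoord n} (hp : p.1 ∈ c.target) (hp' : p.2.IsInvertible) :
    Frame.ofCoord c p = ⟨c.symm p.1,
      (mfderiv 𝓘(ℝ, Rn n) 𝓘(ℝ, Rn n) c.symm p.1 : Rn n →L[ℝ] _) ∘L p.2,
      (h.symm.isInvertible hp).comp hp'⟩ :=
  Frame.mkOf_eq _

theorem Frame.coord_ofCoord {c : OpenPartialHomeomorph M (Rn n)} (h : IsLocalDiffeo (n := n) c)
    {p : FrameCoord n} (hp : p.1 ∈ c.target) (hp' : p.2.IsInvertible) :
    (Frame.ofCoord c p).coord c = p := by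
  rw [Frame.ofCoord_eq h hp hp']
  refine Prod.ext (c.right_inv hp) ?_
  have := h.mdifferentiable.comp_symm_deriv hp
  ext v
  exact DFunLike.congr_fun (congrArg (fun T => (T : Rn n →L[ℝ] Rn n)) this) (p.2 v) ▸ rfl

theorem Frame.coord_injOn {c : OpenPartialHomeomorph M (Rn n)} (h : IsLocalDiffeo (n := n) c)
    {X Y : Frame n M} (hX : X.base ∈ c.source) (hY : Y.base ∈ c.source)
    (hXY : X.coord c = Y.coord c) : X = Y := by
  obtain ⟨x, A, hA⟩ := X
  obtain ⟨y, B, hB⟩ := Y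
  obtain rfl : x = y := c.injOn hX hY (congrArg Prod.fst hXY)
  have h2 := congrArg Prod.snd hXY
  obtain ⟨T, hT⟩ := h.isInvertible hX
  have : A = B := by
    ext1 v
    have := DFunLike.congr_fun h2 v
    simp only [Frame.coord] at this
    rw [← hT] at this
    exact T.injective this
  subst this
  rfl

theorem Frame.ofCoord_coord {c : OpenPartialHomeomorph M (Rn n)} (h : IsLocalDiffeo (n := n) c)
    {X : Frame n M} (hX : X.base ∈ c.source) : Frame.ofCoord c (X.coord c) = X := by
  have h1 : (X.coord c).1 ∈ c.target := c.map_source hX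
  refine Frame.coord_injOn h ?_ hX
    (Frame.coord_ofCoord h h1 (Frame.coord_snd_isInvertible h hX))
  rw [Frame.base_ofCoord]
  exact c.map_target h1

/-- The map `Fφ` of frames induced by a local diffeomorphism `φ`. -/
noncomputable def Frame.map (φ : M → N) (X : Frame n M) : Frame n N :=
  Frame.mkOf (φ X.base) (mfderiv 𝓘(ℝ, Rn n) 𝓘(ℝ, Rn n) φ X.base ∘L X.lin)

theorem Frame.map_eq {φ : OpenPartialHomeomorph M N} (h : IsLocalDiffeo (n := n) φ)
    {X : Frame n M} (hX : X.base ∈ φ.source) :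
    X.map φ = ⟨φ X.base, mfderiv 𝓘(ℝ, Rn n) 𝓘(ℝ, Rn n) φ X.base ∘L X.lin,
      (h.isInvertible hX).comp X.isInvertible⟩ :=
  Frame.mkOf_eq _

theorem Frame.ext_lin {X Y : Frame n M} (h : X.base = Y.base)
    (h' : ∀ v, (X.lin v : Rn n) = (Y.lin v : Rn n)) : X = Y := by
  obtain ⟨x, A, hA⟩ := X
  obtain ⟨y, B, hB⟩ := Y
  obtain rfl : x = y := h
  obtain rfl : A = B := by ext1 v; exact h' v
  rfl

theorem Frame.map_symm_map {φ : OpenPartialHomeomorph M N} (h : IsLocalDiffeo (n := n) φ)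
    {X : Frame n M} (hX : X.base ∈ φ.source) : (X.map φ).map φ.symm = X := by
  have hY : (X.map φ).base ∈ φ.symm.source := by
    rw [Frame.map_eq h hX]; exact φ.map_source hX
  rw [Frame.map_eq h.symm hY]
  refine Frame.ext_lin ?_ ?_
  · simp only [Frame.map, Frame.mkOf_base]
    exact φ.left_inv hX
  · intro v
    have key := h.mdifferentiable.symm_comp_deriv hX
    have e : X.map φ = _ := Frame.map_eq h hX
    have aux : ∀ Y : Frame n N, Y = ⟨φ X.base, mfderiv 𝓘(ℝ, Rn n) 𝓘(ℝ, Rn n) φ X.base ∘L X.lin,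
        (h.isInvertible hX).comp X.isInvertible⟩ →
        ((mfderiv 𝓘(ℝ, Rn n) 𝓘(ℝ, Rn n) φ.symm Y.base (Y.lin v) : _) : Rn n) = X.lin v := by
      rintro _ rfl
      exact DFunLike.congr_fun key (X.lin v)
    exact aux _ e

/-- A local isomorphism of principal bundles from `FM` to `FN`, over the identity of `Gl(n, ℝ)`:
a smooth equivariant map between the parts of the frame bundles over open sets of `M` and `N`,
with a smooth inverse, over a homeomorphism `base` of these open sets. Smoothness is expressed in
the induced coordinates of the frame bundles. -/
structure LocalFrameIso (n : ℕ) (M N : Type*) [TopologicalSpace M] [ChartedSpace (Rn n) M]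
    [TopologicalSpace N] [ChartedSpace (Rn n) N] where
  base : OpenPartialHomeomorph M N
  toFun : Frame n M → Frame n N
  invFun : Frame n N → Frame n M
  base_toFun : ∀ X, X.base ∈ base.source → (toFun X).base = base X.base
  base_invFun : ∀ Y, Y.base ∈ base.target → (invFun Y).base = base.symm Y.base
  left_inv : ∀ X, X.base ∈ base.source → invFun (toFun X) = X
  right_inv : ∀ Y, Y.base ∈ base.target → toFun (invFun Y) = Y
  equivariant : ∀ X, X.base ∈ base.source → ∀ g : Rn n ≃L[ℝ] Rn n,
    toFun (X.act g) = (toFun X).act g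
  smooth : ∀ c c', IsCoordSystem c → IsCoordSystem c' → ∀ X : Frame n M, X.base ∈ base.source →
    X.base ∈ c.source → base X.base ∈ c'.source →
    ContDiffAt ℝ ∞ (fun p => (toFun (Frame.ofCoord c p)).coord c') (X.coord c)
  smooth_inv : ∀ c c', IsCoordSystem c → IsCoordSystem c' → ∀ Y : Frame n N, Y.base ∈ base.target →
    Y.base ∈ c.source → base.symm Y.base ∈ c'.source →
    ContDiffAt ℝ ∞ (fun p => (invFun (Frame.ofCoord c p)).coord c') (Y.coord c)

namespace LocalFrameIso

/-- The expression of a local isomorphism `FM → FN` in the induced coordinates. -/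
noncomputable def rep (Ψ : LocalFrameIso n M N) (c : OpenPartialHomeomorph M (Rn n))
    (c' : OpenPartialHomeomorph N (Rn n)) (p : FrameCoord n) : FrameCoord n :=
  (Ψ.toFun (Frame.ofCoord c p)).coord c'

/-- The inverse of a local isomorphism of frame bundles. -/
def symm (Ψ : LocalFrameIso n M N) : LocalFrameIso n N M where
  base := Ψ.base.symm
  toFun := Ψ.invFun
  invFun := Ψ.toFun
  base_toFun := Ψ.base_invFun
  base_invFun := Ψ.base_toFun
  left_inv := Ψ.right_inv
  right_inv := Ψ.left_inv
  equivariant Y hY g := by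
    have h1 : (Ψ.invFun Y).base ∈ Ψ.base.source := by
      rw [Ψ.base_invFun Y hY]; exact Ψ.base.map_target hY
    have h2 := Ψ.equivariant (Ψ.invFun Y) h1 g
    rw [Ψ.right_inv Y hY] at h2
    rw [← h2, Ψ.left_inv]
    exact h1
  smooth := Ψ.smooth_inv
  smooth_inv := Ψ.smooth

/-- `Ψ` and `Φ` have the same `1`-jet at the frames over `x`: they agree there, and so do their
tangent maps (in all induced coordinates). -/
def SameJetAt (x : M) (Ψ Φ : LocalFrameIso n M N) : Prop :=
  ∀ X : Frame n M, X.base = x → Ψ.toFun X = Φ.toFun X ∧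
    ∀ c c', IsCoordSystem c → IsCoordSystem c' → x ∈ c.source → (Ψ.toFun X).base ∈ c'.source →
      fderiv ℝ (Ψ.rep c c') (X.coord c) = fderiv ℝ (Φ.rep c c') (X.coord c)

theorem SameJetAt.refl (x : M) (Ψ : LocalFrameIso n M N) : SameJetAt x Ψ Ψ :=
  fun _ _ => ⟨rfl, fun _ _ _ _ _ _ => rfl⟩

theorem SameJetAt.symm' {x : M} {Ψ Φ : LocalFrameIso n M N} (h : SameJetAt x Ψ Φ) :
    SameJetAt x Φ Ψ := fun X hX =>
  ⟨(h X hX).1.symm, fun c c' hc hc' hx hy =>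
    ((h X hX).2 c c' hc hc' hx (by rwa [(h X hX).1])).symm⟩

theorem SameJetAt.trans' {x : M} {Ψ Φ Θ : LocalFrameIso n M N} (h : SameJetAt x Ψ Φ)
    (h' : SameJetAt x Φ Θ) : SameJetAt x Ψ Θ := fun X hX =>
  ⟨(h X hX).1.trans (h' X hX).1, fun c c' hc hc' hx hy =>
    ((h X hX).2 c c' hc hc' hx hy).trans
      ((h' X hX).2 c c' hc hc' hx (by rwa [← (h X hX).1]))⟩

variable [IsManifold 𝓘(ℝ, Rn n) ∞ M] [IsManifold 𝓘(ℝ, Rn n) ∞ N] [IsManifold 𝓘(ℝ, Rn n) ∞ P]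

/-- Near the coordinates of a frame over `x`, the base points of the frames with coordinates `p`
stay in a given neighbourhood of `x`. -/
theorem eventually_base {c : OpenPartialHomeomorph M (Rn n)} {X : Frame n M}
    (hX : X.base ∈ c.source) {s : Set M} (hs : s ∈ 𝓝 X.base) :
    ∀ᶠ p in 𝓝 (X.coord c), (Frame.ofCoord c p).base ∈ s := by
  have h1 : ContinuousAt c.symm (X.coord c).1 := c.continuousAt_symm (c.map_source hX)
  have h2 : ContinuousAt (fun p : FrameCoord n => c.symm p.1) (X.coord c) :=
    h1.comp (f := Prod.fst) continuousAt_fst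
  have h3 : c.symm (X.coord c).1 = X.base := c.left_inv hX
  simp only [Frame.base_ofCoord]
  exact h2 (by simpa only [h3] using hs)

theorem eventually_valid {c : OpenPartialHomeomorph M (Rn n)} (hc : IsCoordSystem c)
    {X : Frame n M} (hX : X.base ∈ c.source) :
    ∀ᶠ p in 𝓝 (X.coord c), p.1 ∈ c.target ∧ p.2.IsInvertible := by
  have h1 : ∀ᶠ p in 𝓝 (X.coord c), p.1 ∈ c.target :=
    continuousAt_fst.eventually (c.open_target.mem_nhds (c.map_source hX))
  obtain ⟨T, hT⟩ := Frame.coord_snd_isInvertible hc.isLocalDiffeo hX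
  have h2 : ∀ᶠ p in 𝓝 (X.coord c), p.2.IsInvertible :=
    continuousAt_snd.eventually (hT ▸ ContinuousLinearEquiv.nhds T)
  exact h1.and h2

theorem rep_coord (Ψ : LocalFrameIso n M N) {c : OpenPartialHomeomorph M (Rn n)}
    (hc : IsCoordSystem c) (c' : OpenPartialHomeomorph N (Rn n)) {X : Frame n M}
    (hX : X.base ∈ c.source) : Ψ.rep c c' (X.coord c) = (Ψ.toFun X).coord c' := by
  rw [rep, Frame.ofCoord_coord hc.isLocalDiffeo hX]

/-- Chain rule: the coordinate expression of a composition, near a frame. -/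
theorem rep_comp_eventuallyEq (Ψ : LocalFrameIso n M N) (f : Frame n N → Frame n P)
    {c : OpenPartialHomeomorph M (Rn n)}
    {c' : OpenPartialHomeomorph N (Rn n)} (hc' : IsCoordSystem c')
    (c'' : OpenPartialHomeomorph P (Rn n)) {X : Frame n M} (hX : X.base ∈ c.source)
    (hX' : X.base ∈ Ψ.base.source) (hY : Ψ.base X.base ∈ c'.source) :
    (fun p => (f (Ψ.toFun (Frame.ofCoord c p))).coord c'') =ᶠ[𝓝 (X.coord c)]
      (fun q => (f (Frame.ofCoord c' q)).coord c'') ∘ Ψ.rep c c' := by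
  have h : Ψ.base.source ∩ Ψ.base ⁻¹' c'.source ∈ 𝓝 X.base :=
    (Ψ.base.isOpen_inter_preimage c'.open_source).mem_nhds ⟨hX', hY⟩
  filter_upwards [eventually_base hX h] with p hp
  simp only [Function.comp, rep]
  rw [Frame.ofCoord_coord hc'.isLocalDiffeo]
  rw [Ψ.base_toFun _ hp.1]
  exact hp.2

theorem smooth_comp (Ψ : LocalFrameIso n M N) (Φ : LocalFrameIso n N P)
    {c : OpenPartialHomeomorph M (Rn n)} (hc : IsCoordSystem c)
    {c'' : OpenPartialHomeomorph P (Rn n)} (hc'' : IsCoordSystem c'')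
    {X : Frame n M} (hX : X.base ∈ c.source) (hX' : X.base ∈ Ψ.base.source)
    (hY : Ψ.base X.base ∈ Φ.base.source) (hZ : Φ.base (Ψ.base X.base) ∈ c''.source) :
    ContDiffAt ℝ ∞ (fun p => (Φ.toFun (Ψ.toFun (Frame.ofCoord c p))).coord c'')
      (X.coord c) := by
  have hb := Ψ.base_toFun X hX'
  have hc' : IsCoordSystem (chartAt (Rn n) (Ψ.base X.base)) :=
    IsManifold.chart_mem_maximalAtlas _
  have hm := mem_chart_source (Rn n) (Ψ.base X.base)
  refine ContDiffAt.congr_of_eventuallyEq ?_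
    (Ψ.rep_comp_eventuallyEq Φ.toFun hc' c'' hX hX' hm)
  refine ContDiffAt.comp _ ?_ (Ψ.smooth _ _ hc hc' X hX' hX hm)
  rw [Ψ.rep_coord hc _ hX]
  exact Φ.smooth _ _ hc' hc'' (Ψ.toFun X) (by rwa [hb]) (by rwa [hb]) (by rwa [hb])

/-- The composition `Φ ∘ Ψ` of local isomorphisms of frame bundles. -/
noncomputable def trans (Ψ : LocalFrameIso n M N) (Φ : LocalFrameIso n N P) :
    LocalFrameIso n M P where
  base := Ψ.base.trans Φ.base
  toFun := Φ.toFun ∘ Ψ.toFun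
  invFun := Ψ.invFun ∘ Φ.invFun
  base_toFun X hX := by
    have h1 := Ψ.base_toFun X hX.1
    have h2 : (Ψ.toFun X).base ∈ Φ.base.source := by rw [h1]; exact hX.2
    simp [Φ.base_toFun _ h2, h1]
  base_invFun Y hY := by
    have h1 := Φ.base_invFun Y hY.1
    have h2 : (Φ.invFun Y).base ∈ Ψ.base.target := by rw [h1]; exact hY.2
    simp [Ψ.base_invFun _ h2, h1]
  left_inv X hX := by
    have h1 := Ψ.base_toFun X hX.1
    have h2 : (Ψ.toFun X).base ∈ Φ.base.source := by rw [h1]; exact hX.2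
    simp [Φ.left_inv _ h2, Ψ.left_inv X hX.1]
  right_inv Y hY := by
    have h1 := Φ.base_invFun Y hY.1
    have h2 : (Φ.invFun Y).base ∈ Ψ.base.target := by rw [h1]; exact hY.2
    simp [Ψ.right_inv _ h2, Φ.right_inv Y hY.1]
  equivariant X hX g := by
    have h1 := Ψ.base_toFun X hX.1
    have h2 : (Ψ.toFun X).base ∈ Φ.base.source := by rw [h1]; exact hX.2
    simp [Ψ.equivariant X hX.1, Φ.equivariant _ h2]
  smooth _ _ hc hc' _ hX hXc hY := Ψ.smooth_comp Φ hc hc' hXc hX.1 hX.2 hY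
  smooth_inv _ _ hc hc' _ hX hXc hY :=
    Φ.symm.smooth_comp Ψ.symm hc hc' hXc hX.1 hX.2 hY

theorem mem_source_trans {Ψ : LocalFrameIso n M N} {Φ : LocalFrameIso n N P} {x : M} {y : N}
    (hx : x ∈ Ψ.base.source) (hy : Ψ.base x = y) (hx' : y ∈ Φ.base.source) :
    x ∈ (Ψ.trans Φ).base.source := by
  subst hy; exact ⟨hx, hx'⟩

theorem base_trans_apply {Ψ : LocalFrameIso n M N} {Φ : LocalFrameIso n N P} {x : M} {y : N}
    {z : P} (hy : Ψ.base x = y) (hy' : Φ.base y = z) : (Ψ.trans Φ).base x = z := by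
  subst hy; exact hy'

theorem mem_source_symm {Ψ : LocalFrameIso n M N} {x : M} {y : N}
    (hx : x ∈ Ψ.base.source) (hy : Ψ.base x = y) : y ∈ Ψ.symm.base.source := by
  subst hy; exact Ψ.base.map_source hx

theorem base_symm_apply {Ψ : LocalFrameIso n M N} {x : M} {y : N}
    (hx : x ∈ Ψ.base.source) (hy : Ψ.base x = y) : Ψ.symm.base y = x := by
  subst hy; exact Ψ.base.left_inv hx

theorem map_smooth {φ : OpenPartialHomeomorph M N} (h : IsLocalDiffeo (n := n) φ)
    {c : OpenPartialHomeomorph M (Rn n)} (hc : IsCoordSystem c)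
    {c' : OpenPartialHomeomorph N (Rn n)} (hc' : IsCoordSystem c') {X : Frame n M}
    (hX' : X.base ∈ φ.source) (hX : X.base ∈ c.source) (hY : φ X.base ∈ c'.source) :
    ContDiffAt ℝ ∞ (fun p => ((Frame.ofCoord c p).map φ).coord c') (X.coord c) := by
  -- the coordinate expression of `φ`
  set e : OpenPartialHomeomorph (Rn n) (Rn n) := c.symm.trans (φ.trans c') with he
  have hd : IsLocalDiffeo (n := n) e :=
    hc.isLocalDiffeo.symm.trans (h.trans hc'.isLocalDiffeo)
  have hsm : ContDiffOn ℝ ∞ e e.source := contMDiffOn_iff_contDiffOn.1 hd.smooth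
  have hx : (X.coord c).1 ∈ e.source := by
    refine ⟨c.map_source hX, ?_⟩
    have : c.symm (X.coord c).1 = X.base := c.left_inv hX
    change c.symm (X.coord c).1 ∈ (φ.trans c').source
    rw [this]
    exact ⟨hX', hY⟩
  have hopen := e.open_source
  have hat : ContDiffAt ℝ ∞ e (X.coord c).1 := hsm.contDiffAt (hopen.mem_nhds hx)
  have hfd : ContDiffAt ℝ ∞ (fderiv ℝ e) (X.coord c).1 := hat.fderiv_right (by simp)
  have hmain : ContDiffAt ℝ ∞
      (fun p : FrameCoord n => (e p.1, (fderiv ℝ e p.1) ∘L p.2)) (X.coord c) :=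
    (hat.comp (f := Prod.fst) _ contDiffAt_fst).prodMk
      ((hfd.comp (f := Prod.fst) _ contDiffAt_fst).clm_comp contDiffAt_snd)
  refine hmain.congr_of_eventuallyEq ?_
  have h1 : ∀ᶠ p in 𝓝 (X.coord c), p.1 ∈ e.source :=
    continuousAt_fst.eventually (hopen.mem_nhds hx)
  filter_upwards [h1, eventually_valid hc hX] with p hp hp2
  have hps : c.symm p.1 ∈ φ.source := hp.2.1
  have hpt : φ (c.symm p.1) ∈ c'.source := hp.2.2
  have hb : (Frame.ofCoord c p).base ∈ φ.source := by rw [Frame.base_ofCoord]; exact hps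
  rw [Frame.ofCoord_eq hc.isLocalDiffeo hp2.1 hp2.2] at hb ⊢
  rw [Frame.map_eq h hb]
  refine Prod.ext rfl ?_
  have hA := (hc.isLocalDiffeo.symm.mdifferentiable.mdifferentiableAt hp2.1)
  have hB := h.mdifferentiable.mdifferentiableAt hps
  have hC := hc'.isLocalDiffeo.mdifferentiable.mdifferentiableAt hpt
  have hBC : mfderiv 𝓘(ℝ, Rn n) 𝓘(ℝ, Rn n) (c' ∘ φ) (c.symm p.1) = _ := mfderiv_comp _ hC hB
  have key : mfderiv 𝓘(ℝ, Rn n) 𝓘(ℝ, Rn n) ((c' ∘ φ) ∘ c.symm) p.1 = _ :=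
    mfderiv_comp p.1 (hC.comp _ hB) hA
  rw [hBC, mfderiv_eq_fderiv] at key
  ext1 v
  exact (DFunLike.congr_fun key (p.2 v)).symm

/-- The local isomorphism `Fφ` of frame bundles induced by a local diffeomorphism `φ`. -/
noncomputable def ofDiffeo (φ : OpenPartialHomeomorph M N) (h : IsLocalDiffeo (n := n) φ) :
    LocalFrameIso n M N where
  base := φ
  toFun := Frame.map φ
  invFun := Frame.map φ.symm
  base_toFun X _ := Frame.mkOf_base _ _
  base_invFun Y _ := Frame.mkOf_base _ _
  left_inv X hX := Frame.map_symm_map h hX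
  right_inv Y hY := Frame.map_symm_map h.symm hY
  equivariant X hX g := by
    rw [Frame.map_eq h hX, Frame.map_eq (X := X.act g) h hX]
    rfl
  smooth _ _ hc hc' _ hX hXc hY := map_smooth h hc hc' hX hXc hY
  smooth_inv _ _ hc hc' _ hX hXc hY := map_smooth h.symm hc hc' hX hXc hY

theorem differentiableAt_rep (Ψ : LocalFrameIso n M N) {c : OpenPartialHomeomorph M (Rn n)}
    (hc : IsCoordSystem c) {c' : OpenPartialHomeomorph N (Rn n)} (hc' : IsCoordSystem c')
    {X : Frame n M} (hX' : X.base ∈ Ψ.base.source) (hX : X.base ∈ c.source)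
    (hY : Ψ.base X.base ∈ c'.source) : DifferentiableAt ℝ (Ψ.rep c c') (X.coord c) :=
  (Ψ.smooth c c' hc hc' X hX' hX hY).differentiableAt (by simp)

/-- The chain rule for the coordinate expressions. -/
theorem fderiv_rep_trans (Ψ : LocalFrameIso n M N) (Φ : LocalFrameIso n N P)
    {c : OpenPartialHomeomorph M (Rn n)} (hc : IsCoordSystem c)
    {c' : OpenPartialHomeomorph N (Rn n)} (hc' : IsCoordSystem c')
    {c'' : OpenPartialHomeomorph P (Rn n)} (hc'' : IsCoordSystem c'') {X : Frame n M}
    (hX' : X.base ∈ Ψ.base.source) (hX : X.base ∈ c.source)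
    (hY : Ψ.base X.base ∈ c'.source) (hY' : Ψ.base X.base ∈ Φ.base.source)
    (hZ : Φ.base (Ψ.base X.base) ∈ c''.source) :
    fderiv ℝ ((Ψ.trans Φ).rep c c'') (X.coord c) =
      (fderiv ℝ (Φ.rep c' c'') ((Ψ.toFun X).coord c')) ∘L (fderiv ℝ (Ψ.rep c c') (X.coord c)) := by
  have hb := Ψ.base_toFun X hX'
  have h1 := (Ψ.rep_comp_eventuallyEq Φ.toFun hc' c'' hX hX' hY).fderiv_eq (𝕜 := ℝ)
  have h2 : DifferentiableAt ℝ (Φ.rep c' c'') (Ψ.rep c c' (X.coord c)) := by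
    rw [Ψ.rep_coord hc _ hX]
    exact Φ.differentiableAt_rep hc' hc'' (by rwa [hb]) (by rwa [hb]) (by rwa [hb])
  refine h1.trans ((fderiv_comp _ h2 (Ψ.differentiableAt_rep hc hc' hX' hX hY)).trans ?_)
  rw [Ψ.rep_coord hc _ hX]

/-- The tangent map of the inverse is the inverse of the tangent map. -/
theorem fderiv_rep_symm (Ψ : LocalFrameIso n M N)
    {c : OpenPartialHomeomorph M (Rn n)} (hc : IsCoordSystem c)
    {c' : OpenPartialHomeomorph N (Rn n)} (hc' : IsCoordSystem c') {X : Frame n M}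
    (hX' : X.base ∈ Ψ.base.source) (hX : X.base ∈ c.source)
    (hY : Ψ.base X.base ∈ c'.source) :
    (fderiv ℝ (Ψ.symm.rep c' c) ((Ψ.toFun X).coord c')) ∘L (fderiv ℝ (Ψ.rep c c') (X.coord c)) =
      ContinuousLinearMap.id ℝ _ := by
  have hs : Ψ.base X.base ∈ Ψ.symm.base.source := Ψ.base.map_source hX'
  have hl : Ψ.symm.base (Ψ.base X.base) = X.base := Ψ.base.left_inv hX'
  rw [← fderiv_rep_trans Ψ Ψ.symm hc hc' hc hX' hX hY hs (by rwa [hl])]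
  have h : (Ψ.trans Ψ.symm).rep c c =ᶠ[𝓝 (X.coord c)] id := by
    filter_upwards [eventually_base hX (Ψ.base.open_source.mem_nhds hX'),
      eventually_valid hc hX] with p hp hp2
    have : Ψ.invFun (Ψ.toFun (Frame.ofCoord c p)) = Frame.ofCoord c p := Ψ.left_inv _ hp
    change (Ψ.invFun (Ψ.toFun (Frame.ofCoord c p))).coord c = p
    rw [this]
    exact Frame.coord_ofCoord hc.isLocalDiffeo hp2.1 hp2.2
  rw [h.fderiv_eq, fderiv_id]

theorem sameJetAt_of_eqOn {x : M} {s : Set M} (hs : s ∈ 𝓝 x) {Ψ Φ : LocalFrameIso n M N}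
    (h : ∀ X : Frame n M, X.base ∈ s → Ψ.toFun X = Φ.toFun X) : SameJetAt x Ψ Φ := by
  rintro X rfl
  refine ⟨h X (mem_of_mem_nhds hs), fun c c' _ _ hX _ => ?_⟩
  refine Filter.EventuallyEq.fderiv_eq ?_
  filter_upwards [eventually_base hX hs] with p hp
  simp only [rep, h _ hp]

theorem SameJetAt.comp {x : M} {Ψ Ψ' : LocalFrameIso n M N} {Φ Φ' : LocalFrameIso n N P}
    (hx : x ∈ Ψ.base.source) (hx' : x ∈ Ψ'.base.source) (hy : Ψ.base x ∈ Φ.base.source)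
    (hy' : Ψ.base x ∈ Φ'.base.source)
    (h : SameJetAt x Ψ Ψ') (h' : SameJetAt (Ψ.base x) Φ Φ') :
    SameJetAt x (Ψ.trans Φ) (Ψ'.trans Φ') := by
  rintro X rfl
  have hb := Ψ.base_toFun X hx
  have hb' := Ψ'.base_toFun X hx'
  have h1 := (h X rfl).1
  have h2 := (h' (Ψ.toFun X) hb).1
  have hbb : Ψ'.base X.base = Ψ.base X.base := by rw [← hb', ← h1, hb]
  refine ⟨?_, ?_⟩
  · change Φ.toFun (Ψ.toFun X) = Φ'.toFun (Ψ'.toFun X)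
    rw [← h1, h2]
  · intro c c'' hc hc'' hX hZ
    have hZ : (Φ.toFun (Ψ.toFun X)).base ∈ c''.source := hZ
    have hZ1 := Φ.base_toFun (Ψ.toFun X) (by rwa [hb])
    have hZ2 := Φ'.base_toFun (Ψ.toFun X) (by rwa [hb])
    have hc' : IsCoordSystem (chartAt (Rn n) (Ψ.base X.base)) :=
      IsManifold.chart_mem_maximalAtlas _
    have hm := mem_chart_source (Rn n) (Ψ.base X.base)
    rw [fderiv_rep_trans Ψ Φ hc hc' hc'' hx hX hm hy (by rwa [← hb, ← hZ1]),
      fderiv_rep_trans Ψ' Φ' hc hc' hc'' hx' hX (by rwa [hbb]) (by rwa [hbb])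
        (by rw [hbb, ← hb, ← hZ2, ← h2]; exact hZ),
      ← h1, (h X rfl).2 _ _ hc hc' hX (by rwa [hb]),
      (h' (Ψ.toFun X) hb).2 _ _ hc' hc'' hm hZ]

theorem SameJetAt.inv {x : M} {Ψ Ψ' : LocalFrameIso n M N}
    (hx : x ∈ Ψ.base.source) (hx' : x ∈ Ψ'.base.source) (hy : Ψ'.base x = Ψ.base x)
    (h : SameJetAt x Ψ Ψ') : SameJetAt (Ψ.base x) Ψ.symm Ψ'.symm := by
  intro Y hY
  have hYt : Y.base ∈ Ψ.base.target := by rw [hY]; exact Ψ.base.map_source hx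
  have hX : (Ψ.invFun Y).base = x := by
    rw [Ψ.base_invFun Y hYt, hY, Ψ.base.left_inv hx]
  have hΨ : Ψ.toFun (Ψ.invFun Y) = Y := Ψ.right_inv Y hYt
  obtain ⟨h1, h2⟩ := h (Ψ.invFun Y) hX
  have hΨ' : Ψ'.toFun (Ψ.invFun Y) = Y := by rw [← h1, hΨ]
  have h3 : Ψ.invFun Y = Ψ'.invFun Y := by
    rw [← Ψ'.left_inv (Ψ.invFun Y) (by rwa [hX]), hΨ']
  refine ⟨h3, fun c' c hc' hc hyc hxc => ?_⟩
  have hxc : x ∈ c.source := by rw [← hX]; exact hxc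
  have e := h2 c c' hc hc' hxc (by rw [hΨ, hY]; exact hyc)
  -- both derivatives are inverse to the same map
  have a1 := fderiv_rep_symm Ψ hc hc' (X := Ψ.invFun Y) (by rwa [hX]) (by rwa [hX])
    (by rwa [hX])
  have a2 := fderiv_rep_symm Ψ' hc hc' (X := Ψ.invFun Y) (by rwa [hX]) (by rwa [hX])
    (by rwa [hX, hy])
  have b1 := fderiv_rep_symm Ψ.symm hc' hc (X := Y) (by rwa [← hY] at *)
    (by rwa [hY]) (by
      have : Ψ.base.symm Y.base = x := by rw [hY, Ψ.base.left_inv hx]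
      change Ψ.base.symm Y.base ∈ c.source
      rwa [this])
  rw [hΨ] at a1
  rw [hΨ', ← e] at a2
  have b1 : (fderiv ℝ (Ψ.rep c c') ((Ψ.invFun Y).coord c)) ∘L
      (fderiv ℝ (Ψ.symm.rep c' c) (Y.coord c')) = ContinuousLinearMap.id ℝ _ := b1
  calc fderiv ℝ (Ψ.symm.rep c' c) (Y.coord c')
      = (fderiv ℝ (Ψ'.symm.rep c' c) (Y.coord c') ∘L
          fderiv ℝ (Ψ.rep c c') ((Ψ.invFun Y).coord c)) ∘L
          fderiv ℝ (Ψ.symm.rep c' c) (Y.coord c') := by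
        rw [a2]; rfl
    _ = fderiv ℝ (Ψ'.symm.rep c' c) (Y.coord c') := by
        rw [ContinuousLinearMap.comp_assoc, b1]; rfl

/-- The coordinates `(yʲᵢ, yʲ,ᵢ, yʲᵢ,ₖ)` of the jet of `Ψ` at `x`: the value of `yʲᵢ ∘ Ψ` at
`(e₁)ₓ`, and the partial derivatives there of `yʲ ∘ Ψ` and of `yʲᵢ ∘ Ψ` in the directions `xᵏ`.
The last one is the map `v ↦ ∑ₖ vᵏ yʲᵢ,ₖ`. -/
noncomputable def jetCoord (Ψ : LocalFrameIso n M N) (c : OpenPartialHomeomorph M (Rn n))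
    (c' : OpenPartialHomeomorph N (Rn n)) (x : M) : JetCoord n :=
  let X := Frame.std c x
  let D : Rn n →L[ℝ] FrameCoord n :=
    (fderiv ℝ (Ψ.rep c c') (X.coord c)) ∘L ContinuousLinearMap.inl ℝ (Rn n) (Rn n →L[ℝ] Rn n)
  (((Ψ.toFun X).coord c').2,
    (ContinuousLinearMap.fst ℝ (Rn n) (Rn n →L[ℝ] Rn n)) ∘L D,
    (ContinuousLinearMap.snd ℝ (Rn n) (Rn n →L[ℝ] Rn n)) ∘L D)

theorem SameJetAt.jetCoord_eq {x : M} {Ψ Φ : LocalFrameIso n M N} (h : SameJetAt x Ψ Φ)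
    (hx : x ∈ Ψ.base.source) {c : OpenPartialHomeomorph M (Rn n)} (hc : IsCoordSystem c)
    {c' : OpenPartialHomeomorph N (Rn n)} (hc' : IsCoordSystem c') (hxc : x ∈ c.source)
    (hy : Ψ.base x ∈ c'.source) : Ψ.jetCoord c c' x = Φ.jetCoord c c' x := by
  have hb : (Frame.std c x).base = x := Frame.mkOf_base _ _
  have h' := h (Frame.std c x) hb
  have h2 := h'.2 c c' hc hc' hxc (by rw [Ψ.base_toFun _ (by rwa [hb]), hb]; exact hy)
  simp only [jetCoord, h'.1, h2]

end LocalFrameIso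

open LocalFrameIso

variable [IsManifold 𝓘(ℝ, Rn n) ∞ M] [IsManifold 𝓘(ℝ, Rn n) ∞ N] [IsManifold 𝓘(ℝ, Rn n) ∞ P]

/-- The local isomorphisms of frame bundles defined over a neighbourhood of `x`, whose base map
sends `x` to `y`. -/
abbrev LocalFrameIsoAt (n : ℕ) {M N : Type*} [TopologicalSpace M] [ChartedSpace (Rn n) M]
    [TopologicalSpace N] [ChartedSpace (Rn n) N] (x : M) (y : N) :=
  {Ψ : LocalFrameIso n M N // x ∈ Ψ.base.source ∧ Ψ.base x = y}

/-- Equality of `1`-jets over `x`. -/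
def jetSetoid (n : ℕ) {M N : Type*} [TopologicalSpace M] [ChartedSpace (Rn n) M]
    [TopologicalSpace N] [ChartedSpace (Rn n) N] (x : M) (y : N) :
    Setoid (LocalFrameIsoAt n x y) where
  r Ψ Φ := SameJetAt x Ψ.1 Φ.1
  iseqv := ⟨fun Ψ => SameJetAt.refl x Ψ.1, fun h => h.symm', fun h h' => h.trans' h'⟩

/-- The jets `j¹_{x,y} Ψ`, that is, the classes of the `1`-jets `j¹_{X,Y} Ψ` of local isomorphisms
of frame bundles, with `X` over `x` and `Y = Ψ(X)` over `y`, modulo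
`j¹_{X,Y} Ψ ∼ j¹_{X·g,Y·g} Ψ` for `g` in `Gl(n, ℝ)`. As this group permutes the frames over `x`
transitively, the class of `Ψ` consists of the `1`-jets of `Ψ` at all these frames. -/
def Jet (n : ℕ) {M N : Type*} [TopologicalSpace M] [ChartedSpace (Rn n) M]
    [TopologicalSpace N] [ChartedSpace (Rn n) N] (x : M) (y : N) : Type _ :=
  Quotient (jetSetoid n x y)

namespace Jet

/-- The jet `j¹_{x,y} Ψ`. -/
def mk {x : M} {y : N} (Ψ : LocalFrameIso n M N) (hx : x ∈ Ψ.base.source)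
    (hy : Ψ.base x = y) : Jet n x y :=
  Quotient.mk (jetSetoid n x y) ⟨Ψ, hx, hy⟩

theorem mk_eq_mk {x : M} {y : N} {Ψ Φ : LocalFrameIso n M N} {hx : x ∈ Ψ.base.source}
    {hy : Ψ.base x = y} {hx' : x ∈ Φ.base.source} {hy' : Φ.base x = y} :
    mk Ψ hx hy = mk Φ hx' hy' ↔ SameJetAt x Ψ Φ :=
  Quotient.eq (r := jetSetoid n x y)

theorem exists_rep {x : M} {y : N} (j : Jet n x y) :
    ∃ (Ψ : LocalFrameIso n M N) (hx : x ∈ Ψ.base.source) (hy : Ψ.base x = y), j = mk Ψ hx hy := by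
  obtain ⟨⟨Ψ, hx, hy⟩, rfl⟩ := Quotient.exists_rep j
  exact ⟨Ψ, hx, hy, rfl⟩

/-- The composition of jets, `j¹_{y,z} Φ · j¹_{x,y} Ψ = j¹_{x,z} (Φ ∘ Ψ)`. -/
noncomputable def comp {x : M} {y : N} {z : P} (j : Jet n x y) (k : Jet n y z) : Jet n x z :=
  Quotient.map₂ (sa := jetSetoid n x y) (sb := jetSetoid n y z) (sc := jetSetoid n x z)
    (fun Ψ Φ => ⟨Ψ.1.trans Φ.1, mem_source_trans Ψ.2.1 Ψ.2.2 Φ.2.1,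
      base_trans_apply Ψ.2.2 Φ.2.2⟩)
    (fun Ψ Ψ' h Φ Φ' h' => SameJetAt.comp Ψ.2.1 Ψ'.2.1 (by rw [Ψ.2.2]; exact Φ.2.1)
      (by rw [Ψ.2.2]; exact Φ'.2.1) h (by rw [Ψ.2.2]; exact h')) j k

/-- The inverse of a jet. -/
noncomputable def inv {x : M} {y : N} (j : Jet n x y) : Jet n y x :=
  Quotient.map (sa := jetSetoid n x y) (sb := jetSetoid n y x)
    (fun Ψ => ⟨Ψ.1.symm, mem_source_symm Ψ.2.1 Ψ.2.2, base_symm_apply Ψ.2.1 Ψ.2.2⟩)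
    (fun Ψ Ψ' h => by
      have := SameJetAt.inv Ψ.2.1 Ψ'.2.1 (by rw [Ψ.2.2, Ψ'.2.2]) h
      rwa [Ψ.2.2] at this) j

/-- The jet `j¹_{x,y} (Fφ)` of a local diffeomorphism `φ` with `φ(x) = y`. -/
noncomputable def ofDiffeo (φ : OpenPartialHomeomorph M N) (h : IsLocalDiffeo (n := n) φ)
    {x : M} {y : N} (hx : x ∈ φ.source) (hy : φ x = y) : Jet n x y :=
  mk (LocalFrameIso.ofDiffeo φ h) (show x ∈ (LocalFrameIso.ofDiffeo φ h).base.source from hx) hy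

/-- The jet of the identity. -/
noncomputable def refl (n : ℕ) {M : Type*} [TopologicalSpace M] [ChartedSpace (Rn n) M]
    [IsManifold 𝓘(ℝ, Rn n) ∞ M] (x : M) : Jet n x x :=
  ofDiffeo (OpenPartialHomeomorph.refl M) IsLocalDiffeo.refl (mem_univ x) rfl

/-- The coordinates `(yʲᵢ, yʲ,ᵢ, yʲᵢ,ₖ)` of the jet `j¹_{x,y} Ψ`, for `x` and `y` in the domains of
the coordinate systems `c` and `c'`. They do not depend on the representative: see `coord_mk`. -/
noncomputable def coord {x : M} {y : N} (c : OpenPartialHomeomorph M (Rn n))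
    (c' : OpenPartialHomeomorph N (Rn n)) (j : Jet n x y) : JetCoord n :=
  (Quotient.out (s := jetSetoid n x y) j).1.jetCoord c c' x

theorem coord_mk {x : M} {y : N} (Ψ : LocalFrameIso n M N) (hx : x ∈ Ψ.base.source)
    (hy : Ψ.base x = y) {c : OpenPartialHomeomorph M (Rn n)} (hc : IsCoordSystem c)
    {c' : OpenPartialHomeomorph N (Rn n)} (hc' : IsCoordSystem c') (hxc : x ∈ c.source)
    (hyc : y ∈ c'.source) : (mk Ψ hx hy).coord c c' = Ψ.jetCoord c c' x := by
  have h : SameJetAt x (Quotient.out (s := jetSetoid n x y) (mk Ψ hx hy)).1 Ψ :=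
    Quotient.exact (s := jetSetoid n x y)
      (Quotient.out_eq (s := jetSetoid n x y) (mk Ψ hx hy))
  have hr := (Quotient.out (s := jetSetoid n x y) (mk Ψ hx hy)).2
  exact h.jetCoord_eq hr.1 hc hc' hxc (by rw [hr.2]; exact hyc)

theorem comp_mk {x : M} {y : N} {z : P} {Ψ : LocalFrameIso n M N} {hx : x ∈ Ψ.base.source}
    {hy : Ψ.base x = y} {Φ : LocalFrameIso n N P} {hx' : y ∈ Φ.base.source} {hy' : Φ.base y = z} :
    (mk Ψ hx hy).comp (mk Φ hx' hy') =
      mk (Ψ.trans Φ) (mem_source_trans hx hy hx') (base_trans_apply hy hy') := rfl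

theorem inv_mk {x : M} {y : N} {Ψ : LocalFrameIso n M N} {hx : x ∈ Ψ.base.source}
    {hy : Ψ.base x = y} :
    (mk Ψ hx hy).inv = mk Ψ.symm (mem_source_symm hx hy) (base_symm_apply hx hy) := rfl

theorem refl_toFun (X : Frame n M) : X.map (OpenPartialHomeomorph.refl M) = X := by
  have h := Frame.map_symm_map (X := X) IsLocalDiffeo.refl (mem_univ _)
  have h2 := Frame.map_eq (φ := OpenPartialHomeomorph.refl M) (X := X)
    IsLocalDiffeo.refl (mem_univ _)
  rw [h2]
  refine Frame.ext_lin rfl fun v => ?_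
  have : mfderiv 𝓘(ℝ, Rn n) 𝓘(ℝ, Rn n) (OpenPartialHomeomorph.refl M) X.base =
    ContinuousLinearMap.id ℝ _ := mfderiv_id
  exact DFunLike.congr_fun this (X.lin v)

theorem refl_comp {x : M} {y : N} (j : Jet n x y) : (refl n x).comp j = j := by
  obtain ⟨Ψ, hx, hy, rfl⟩ := j.exists_rep
  refine Quotient.sound (s := jetSetoid n x y) ?_
  refine sameJetAt_of_eqOn Filter.univ_mem fun X _ => ?_
  exact congrArg Ψ.toFun (refl_toFun X)

theorem comp_refl {x : M} {y : N} (j : Jet n x y) : j.comp (refl n y) = j := by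
  obtain ⟨Ψ, hx, hy, rfl⟩ := j.exists_rep
  refine Quotient.sound (s := jetSetoid n x y) ?_
  exact sameJetAt_of_eqOn Filter.univ_mem fun X _ => refl_toFun (Ψ.toFun X)

theorem comp_assoc {Q : Type*} [TopologicalSpace Q] [ChartedSpace (Rn n) Q]
    [IsManifold 𝓘(ℝ, Rn n) ∞ Q] {x : M} {y : N} {z : P} {w : Q} (j : Jet n x y) (k : Jet n y z)
    (l : Jet n z w) : (j.comp k).comp l = j.comp (k.comp l) := by
  obtain ⟨Ψ, hx, hy, rfl⟩ := j.exists_rep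
  obtain ⟨Φ, hx', hy', rfl⟩ := k.exists_rep
  obtain ⟨Θ, hx'', hy'', rfl⟩ := l.exists_rep
  refine Quotient.sound (s := jetSetoid n x w) ?_
  exact sameJetAt_of_eqOn Filter.univ_mem fun X _ => rfl

theorem comp_inv {x : M} {y : N} (j : Jet n x y) : j.comp j.inv = refl n x := by
  obtain ⟨Ψ, hx, hy, rfl⟩ := j.exists_rep
  refine Quotient.sound (s := jetSetoid n x x) ?_
  refine sameJetAt_of_eqOn (Ψ.base.open_source.mem_nhds hx) fun X hX => ?_
  exact (Ψ.left_inv X hX).trans (refl_toFun X).symm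

theorem inv_comp {x : M} {y : N} (j : Jet n x y) : j.inv.comp j = refl n y := by
  obtain ⟨Ψ, hx, hy, rfl⟩ := j.exists_rep
  have hyt : y ∈ Ψ.base.target := by subst hy; exact Ψ.base.map_source hx
  refine Quotient.sound (s := jetSetoid n y y) ?_
  refine sameJetAt_of_eqOn (Ψ.base.open_target.mem_nhds hyt) fun X hX => ?_
  exact (Ψ.right_inv X hX).trans (refl_toFun X).symm

end Jet

end Frames

section Groupoid

/-- The manifold `M`, regarded as the set of objects of its second-order non-holonomic groupoid. -/
def JetObj (_n : ℕ) (M : Type*) : Type _ := M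

variable {n : ℕ} {M : Type*} [TopologicalSpace M] [ChartedSpace (Rn n) M]
  [IsManifold 𝓘(ℝ, Rn n) ∞ M]

/-- The second-order non-holonomic groupoid `J̃¹(FM) ⇉ M`: the arrows from `x` to `y` are the jets
`j¹_{x,y} Ψ`. -/
noncomputable instance : Groupoid (JetObj n M) where
  Hom x y := Jet (M := M) (N := M) n x y
  id x := Jet.refl (M := M) n x
  comp j k := Jet.comp (M := M) (N := M) (P := M) j k
  inv j := Jet.inv (M := M) (N := M) j
  id_comp j := Jet.refl_comp (M := M) (N := M) j
  comp_id j := Jet.comp_refl (M := M) (N := M) j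
  assoc j k l := Jet.comp_assoc (M := M) (N := M) (P := M) (Q := M) j k l
  inv_comp j := Jet.inv_comp (M := M) (N := M) j
  comp_inv j := Jet.comp_inv (M := M) (N := M) j

/-- The origin of `ℝⁿ`. -/
def origin (n : ℕ) : JetObj n (Rn n) := (0 : Rn n)

/-- The group `G̅²(n)`: the isotropy group at `0` of the second-order non-holonomic groupoid
of `ℝⁿ`, that is, the jets `j¹_{0,0} Ψ` of local automorphisms of `Fℝⁿ`, which are the same thing as
the jets `j¹_{e₁,Z} Ψ` with `Z` over `0`. The group structure is that of a vertex group. -/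
abbrev G2 (n : ℕ) : Type := origin n ⟶ origin n

/-- The arrows of `J̃¹(FM)`, with their source and target. -/
structure Arrow (n : ℕ) (M : Type*) [TopologicalSpace M] [ChartedSpace (Rn n) M]
    [IsManifold 𝓘(ℝ, Rn n) ∞ M] where
  src : JetObj n M
  tgt : JetObj n M
  jet : src ⟶ tgt

/-- The space of the coordinates `(xⁱ, yʲ, yʲᵢ, yʲ,ᵢ, yʲᵢ,ₖ)` of the arrows. -/
abbrev ArrowCoord (n : ℕ) := Rn n × Rn n × JetCoord n

/-- The coordinates `(yʲᵢ, yʲ,ᵢ, yʲᵢ,ₖ)` of an arrow of `J̃¹(FM)`. -/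
noncomputable def homCoord (c c' : OpenPartialHomeomorph M (Rn n)) {x y : JetObj n M}
    (j : x ⟶ y) : JetCoord n :=
  Jet.coord (M := M) (N := M) (x := x) (y := y) c c' j

/-- The coordinates `(xⁱ, yʲ, yʲᵢ, yʲ,ᵢ, yʲᵢ,ₖ)` on `J̃¹(FU, FV)`, for coordinate systems `c` on `U`
and `c'` on `V`. -/
noncomputable def Arrow.coord (c c' : OpenPartialHomeomorph M (Rn n)) (a : Arrow n M) :
    ArrowCoord n :=
  (c (a.src : M), c' (a.tgt : M), homCoord c c' a.jet)

/-- For a subgroupoid `Γ` of `J̃¹(FM)`, the set `Γ(FU, FV)` of its arrows with source in `U` and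
target in `V`. -/
def arrowsOver (Γ : Subgroupoid (JetObj n M)) (U V : Set M) : Set (Arrow n M) :=
  {a | (a.src : M) ∈ U ∧ (a.tgt : M) ∈ V ∧ a.jet ∈ Γ.arrows a.src a.tgt}

section Submanifolds

variable {V W : Type*} [NormedAddCommGroup V] [NormedSpace ℝ V]
  [NormedAddCommGroup W] [NormedSpace ℝ W]

/-- `S` is an embedded submanifold of the (finite-dimensional) space `V`: near each of its points,
it is the zero set of a smooth map to some `ℝᵏ` that is a submersion at that point. -/
def IsEmbeddedSubmanifold (S : Set V) : Prop :=
  ∀ p ∈ S, ∃ (k : ℕ) (f : V → EuclideanSpace ℝ (Fin k)) (O : Set V), IsOpen O ∧ p ∈ O ∧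
    ContDiffOn ℝ ∞ f O ∧ Function.Surjective (fderiv ℝ f p) ∧ S ∩ O = {q ∈ O | f q = 0}

/-- The tangent vectors to `S` at `p`: the velocities of the curves in `S` through `p`. -/
def tangentVectors (S : Set V) (p : V) : Set V :=
  {v | ∃ γ : ℝ → V, γ 0 = p ∧ (∀ᶠ t in 𝓝 (0 : ℝ), γ t ∈ S) ∧ HasDerivAt γ v 0}

/-- The map `f`, on the set `S`, is smooth with respect to the coordinates `κ` in its domain and
`κ'` in its codomain. -/
def IsSmoothInCoords {A B : Type*} (κ : A → V) (κ' : B → W) (f : A → B) (S : Set A) : Prop :=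
  ∃ F : V → W, ContDiffOn ℝ ∞ F (κ '' S) ∧ ∀ a ∈ S, κ' (f a) = F (κ a)

end Submanifolds

/-- `Γ` is a reduced Lie subgroupoid of `J̃¹(FM)`: it is a wide transitive subgroupoid, and an
embedded submanifold (as seen in the induced coordinates) on which the source and
the target maps are submersions. (The other structure maps of `Γ` are smooth as restrictions of
smooth maps to embedded submanifolds.) -/
structure IsReducedLieSubgroupoid (Γ : Subgroupoid (JetObj n M)) : Prop where
  wide : Γ.IsWide
  transitive : ∀ x y, (Γ.arrows x y).Nonempty
  embedded : ∀ c c' : OpenPartialHomeomorph M (Rn n), IsCoordSystem c → IsCoordSystem c' →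
    IsEmbeddedSubmanifold (Arrow.coord c c' '' arrowsOver Γ c.source c'.source)
  source_submersion : ∀ c c' : OpenPartialHomeomorph M (Rn n), IsCoordSystem c →
    IsCoordSystem c' → ∀ p ∈ Arrow.coord c c' '' arrowsOver Γ c.source c'.source, ∀ v : Rn n,
      ∃ w ∈ tangentVectors (Arrow.coord c c' '' arrowsOver Γ c.source c'.source) p, w.1 = v
  target_submersion : ∀ c c' : OpenPartialHomeomorph M (Rn n), IsCoordSystem c →
    IsCoordSystem c' → ∀ p ∈ Arrow.coord c c' '' arrowsOver Γ c.source c'.source, ∀ v : Rn n,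
      ∃ w ∈ tangentVectors (Arrow.coord c c' '' arrowsOver Γ c.source c'.source) p, w.2.1 = v

/-- The coordinates on `G̅²(n)`, from the standard coordinates of `ℝⁿ`. -/
noncomputable def G2.coord (g : G2 n) : JetCoord n :=
  homCoord (OpenPartialHomeomorph.refl (Rn n)) (OpenPartialHomeomorph.refl (Rn n)) g

/-- `G` is a Lie subgroup of `G̅²(n)`: a subgroup that is an embedded submanifold. -/
def IsLieSubgroup (G : Subgroup (G2 n)) : Prop :=
  IsEmbeddedSubmanifold (G2.coord '' (G : Set (G2 n)))

/-- The translation `τ_v` of `ℝⁿ`. -/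
noncomputable def translation (v : Rn n) : OpenPartialHomeomorph (Rn n) (Rn n) :=
  (Homeomorph.addRight v).toOpenPartialHomeomorph

theorem translation_isLocalDiffeo (v : Rn n) : IsLocalDiffeo (n := n) (translation v) := by
  constructor
  · exact (contMDiff_iff_contDiff.2 (contDiff_id.add contDiff_const)).contMDiffOn
  · exact (contMDiff_iff_contDiff.2
      (contDiff_id.add (contDiff_const (c := -v)))).contMDiffOn

/-- The jet `j¹_{0,x} F(c⁻¹ ∘ τ_{c(x)})`, for a coordinate system `c` around `x`. -/
noncomputable def jetFromOrigin (c : OpenPartialHomeomorph M (Rn n)) (hc : IsCoordSystem c) (x : M)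
    (hx : x ∈ c.source) : Jet n (0 : Rn n) x :=
  Jet.ofDiffeo ((translation (c x)).trans c.symm)
    ((translation_isLocalDiffeo _).trans hc.isLocalDiffeo.symm)
    (by simp [translation, hx]) (by simp [translation, hx])

/-- The jet `j¹_{y,0} F(τ_{-c(y)} ∘ c)`, for a coordinate system `c` around `y`. -/
noncomputable def jetToOrigin (c : OpenPartialHomeomorph M (Rn n)) (hc : IsCoordSystem c) (y : M)
    (hy : y ∈ c.source) : Jet n y (0 : Rn n) :=
  Jet.ofDiffeo (c.trans (translation (-c y)))
    (hc.isLocalDiffeo.trans (translation_isLocalDiffeo _))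
    (by simp [translation, hy]) (by simp [translation])

/-- For a coordinate system `c = ψ_U` on `U` and `x`, `y` in `U`, the map
`j¹_{x,y} Ψ ↦ j¹_{0,0} (F(τ_{-c(y)} ∘ c) ∘ Ψ ∘ F(c⁻¹ ∘ τ_{c(x)}))` with values in `G̅²(n)`. -/
noncomputable def localIsotropy (c : OpenPartialHomeomorph M (Rn n)) (hc : IsCoordSystem c)
    {x y : JetObj n M} (hx : (x : M) ∈ c.source) (hy : (y : M) ∈ c.source) (j : x ⟶ y) : G2 n :=
  Jet.comp (M := Rn n) (N := M) (P := Rn n) (jetFromOrigin c hc x hx)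
    (Jet.comp (M := M) (N := M) (P := Rn n) (show Jet (M := M) (N := M) n x y from j)
      (jetToOrigin c hc y hy))

open scoped Classical in
/-- The map `Ψ_U : J̃¹(FU) → ℝⁿ × ℝⁿ × G̅²(n)` induced by a coordinate system `c = ψ_U` on `U`
(extended by a constant to the arrows that are not over `U`). -/
noncomputable def toTrivial (c : OpenPartialHomeomorph M (Rn n)) (hc : IsCoordSystem c)
    (a : Arrow n M) : Rn n × Rn n × G2 n :=
  (c (a.src : M), c (a.tgt : M),
    if h : (a.src : M) ∈ c.source ∧ (a.tgt : M) ∈ c.source then localIsotropy c hc h.1 h.2 a.jet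
    else 1)

/-- The coordinates on the trivial groupoid `ℝⁿ × ℝⁿ × G̅²(n)`. -/
noncomputable def trivialCoord (p : Rn n × Rn n × G2 n) : ArrowCoord n :=
  (p.1, p.2.1, G2.coord p.2.2)

/-- The set `U̅ × U̅ × G`, for `U̅ = c(U)`. -/
def trivialOver (G : Subgroup (G2 n)) (c : OpenPartialHomeomorph M (Rn n)) :
    Set (Rn n × Rn n × G2 n) :=
  {p | p.1 ∈ c.target ∧ p.2.1 ∈ c.target ∧ p.2.2 ∈ G}

/-- The coordinate system `c` on `U` induces an isomorphism of Lie groupoids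
`Γ(FU) → U̅ × U̅ × G` onto (the restriction to `U̅` of) the trivial Lie groupoid of group `G`: the
induced map is a bijection, compatible with the composition of arrows, smooth and with smooth
inverse. -/
structure InducesIso (Γ : Subgroupoid (JetObj n M)) (G : Subgroup (G2 n))
    (c : OpenPartialHomeomorph M (Rn n)) (hc : IsCoordSystem c) : Prop where
  bijOn : BijOn (toTrivial c hc) (arrowsOver Γ c.source c.source) (trivialOver G c)
  map_comp : ∀ (x y z : JetObj n M) (hx : (x : M) ∈ c.source) (hy : (y : M) ∈ c.source)
    (hz : (z : M) ∈ c.source), ∀ j ∈ Γ.arrows x y, ∀ k ∈ Γ.arrows y z,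
      localIsotropy c hc hx hz (j ≫ k) = localIsotropy c hc hx hy j ≫ localIsotropy c hc hy hz k
  smooth : IsSmoothInCoords (Arrow.coord c c) trivialCoord (toTrivial c hc)
    (arrowsOver Γ c.source c.source)
  smooth_inv : ∃ g : Rn n × Rn n × G2 n → Arrow n M,
    InvOn g (toTrivial c hc) (arrowsOver Γ c.source c.source) (trivialOver G c) ∧
    IsSmoothInCoords trivialCoord (Arrow.coord c c) g (trivialOver G c)

/-- `Γ` is integrable: for some Lie subgroup `G` of `G̅²(n)`, it is locally isomorphic to the
trivial Lie groupoid `ℝⁿ × ℝⁿ × G`, by isomorphisms induced by coordinate systems of `M`. -/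
def IsIntegrable (Γ : Subgroupoid (JetObj n M)) : Prop :=
  ∃ G : Subgroup (G2 n), IsLieSubgroup G ∧
    ∀ x : M, ∃ (c : OpenPartialHomeomorph M (Rn n)) (hc : IsCoordSystem c),
      x ∈ c.source ∧ InducesIso Γ G c hc

/-- The flat local section `(xⁱ, yʲ) ↦ ((xⁱ, yʲ, δʲᵢ), δʲᵢ, 0)` of the coordinate system `c` takes
values in `Γ`. -/
def FlatSectionIn (Γ : Subgroupoid (JetObj n M)) (c : OpenPartialHomeomorph M (Rn n)) : Prop :=
  ∀ x y : JetObj n M, (x : M) ∈ c.source → (y : M) ∈ c.source → ∃ j ∈ Γ.arrows x y,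
    homCoord c c j = (ContinuousLinearMap.id ℝ (Rn n), ContinuousLinearMap.id ℝ (Rn n), 0)

end Groupoid

end NonHolonomic

/-!
A coordinate system `c` on `U` identifies the arrows over `U` with `U̅ × U̅ × G̅²(n)`, and this
identification is the identity in coordinates, because conjugating by translations does not change
jet coordinates (`coord_localIsotropy`). As a jet is determined by its coordinates
(`Jet.coord_injective`, by equivariance), the flat section of `c` consists of the arrows sent to
`(u, v, 1)`. If `Γ` is integrable, these arrows lie in `Γ`, which is one implication
(`InducesIso.flatSectionIn`).

Conversely, suppose that the flat section of `c` takes values in `Γ`. Moving an arrow of `Γ` along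
flat jets shows that `Γ` over `U` is the trivial groupoid of the group `G` obtained by transporting
to `0` an isotropy group of `Γ` (`FlatSectionIn.exists_isAdapted`); `c` is then called adapted to
`G`. The group `G` depends on `c`: even on overlapping domains, two flat coordinate systems may have
distinct, merely conjugate, groups. So coordinate systems adapted to one fixed group have to be
found around all points. The translations in the flat coordinates `c` are local diffeomorphisms `T`
of `M` whose jets all lie in `Γ`, so that `e ∘ T` is adapted to `G` whenever `e` is
(`IsAdapted.trans`). Hence if one point of `U` has a coordinate system adapted to `G`, all of them
do (`FlatSectionIn.exists_isAdapted_of_mem`); the set of the points with this property is open and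
closed, and connectedness concludes.

Finally, `G` is a Lie subgroup, since `U̅ × U̅ × G` is an embedded submanifold and its slices over a
point of `U̅ × U̅` inherit this property (`IsEmbeddedSubmanifold.of_prod`).
-/

namespace NonHolonomic

open CategoryTheory Set Topology

set_option linter.unusedSectionVars false

/-! ### Frames and their coordinates -/

section FrameMaps

variable {n : ℕ} {M N P : Type*}
  [TopologicalSpace M] [ChartedSpace (Rn n) M]
  [TopologicalSpace N] [ChartedSpace (Rn n) N]
  [TopologicalSpace P] [ChartedSpace (Rn n) P]

@[simp] theorem Frame.map_base (φ : M → N) (X : Frame n M) : (X.map φ).base = φ X.base :=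
  Frame.mkOf_base _ _

/-- The functoriality of `φ ↦ Fφ`. -/
theorem Frame.map_map {φ : OpenPartialHomeomorph M N} (h : IsLocalDiffeo (n := n) φ)
    {χ : OpenPartialHomeomorph N P} (h' : IsLocalDiffeo (n := n) χ) {X : Frame n M}
    (hX : X.base ∈ φ.source) (hY : φ X.base ∈ χ.source) :
    (X.map φ).map χ = X.map (φ.trans χ) := by
  rw [Frame.map_eq (h.trans h') ⟨hX, hY⟩, Frame.map_eq h hX, Frame.map_eq h' hY]
  refine Frame.ext_lin rfl fun v => ?_
  have key : mfderiv 𝓘(ℝ, Rn n) 𝓘(ℝ, Rn n) (χ ∘ φ) X.base = _ :=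
    mfderiv_comp _ (h'.mdifferentiable.mdifferentiableAt hY)
      (h.mdifferentiable.mdifferentiableAt hX)
  exact (DFunLike.congr_fun key (X.lin v)).symm

/-- `Fφ` at a frame depends only on the germ of `φ`. -/
theorem Frame.map_congr {φ χ : M → N} {X : Frame n M} (h : φ =ᶠ[𝓝 X.base] χ) :
    X.map φ = X.map χ := by
  have aux : ∀ (y y' : N) (A : Rn n →L[ℝ] Rn n), y = y' →
      Frame.mkOf (n := n) y A = Frame.mkOf y' A := by
    rintro y _ A rfl; rfl
  unfold Frame.map
  rw [h.mfderiv_eq]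
  exact aux _ _ _ h.eq_of_nhds

/-- Coordinates of frames are preserved by `Fφ` if `φ` reads, in the charts, as a translation. -/
theorem Frame.coord_map_of_translation {φ : OpenPartialHomeomorph M N}
    (h : IsLocalDiffeo (n := n) φ)
    {c : OpenPartialHomeomorph M (Rn n)} (hc : IsLocalDiffeo (n := n) c)
    {c' : OpenPartialHomeomorph N (Rn n)} (hc' : IsLocalDiffeo (n := n) c')
    {X : Frame n M} (hX : X.base ∈ φ.source) (hXc : X.base ∈ c.source)
    (hY : φ X.base ∈ c'.source) {v : Rn n} (hv : ∀ᶠ x in 𝓝 X.base, c' (φ x) = c x + v) :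
    (X.map φ).coord c' = ((X.coord c).1 + v, (X.coord c).2) := by
  rw [Frame.map_eq h hX]
  refine Prod.ext hv.self_of_nhds ?_
  have key : mfderiv 𝓘(ℝ, Rn n) 𝓘(ℝ, Rn n) (c' ∘ φ) X.base = _ :=
    mfderiv_comp _ (hc'.mdifferentiable.mdifferentiableAt hY)
      (h.mdifferentiable.mdifferentiableAt hX)
  have h1 : (c' ∘ φ) =ᶠ[𝓝 X.base] (translation v) ∘ c := hv
  have h2 : mfderiv 𝓘(ℝ, Rn n) 𝓘(ℝ, Rn n) ((translation v) ∘ c) X.base = _ :=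
    mfderiv_comp _ ((translation_isLocalDiffeo v).mdifferentiable.mdifferentiableAt
      (mem_univ (c X.base))) (hc.mdifferentiable.mdifferentiableAt hXc)
  have h3 : mfderiv 𝓘(ℝ, Rn n) 𝓘(ℝ, Rn n) (translation v) (c X.base) =
      ContinuousLinearMap.id ℝ (Rn n) := by
    rw [mfderiv_eq_fderiv]
    exact (fderiv_add_const (f := id) v).trans fderiv_id
  rw [h1.mfderiv_eq, h2, h3] at key
  ext1 w
  exact (DFunLike.congr_fun key (X.lin w)).symm

theorem Frame.ofCoord_comp (c : OpenPartialHomeomorph M (Rn n)) (h : IsLocalDiffeo (n := n) c)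
    {p : FrameCoord n} (hp : p.1 ∈ c.target) (hp' : p.2.IsInvertible) (g : Rn n ≃L[ℝ] Rn n) :
    Frame.ofCoord c (p.1, p.2 ∘L (g : Rn n →L[ℝ] Rn n)) = (Frame.ofCoord c p).act g := by
  have hg : (p.2 ∘L (g : Rn n →L[ℝ] Rn n)).IsInvertible :=
    hp'.comp ContinuousLinearMap.isInvertible_equiv
  rw [Frame.ofCoord_eq h hp hp']
  exact Frame.ofCoord_eq (p := (p.1, p.2 ∘L (g : Rn n →L[ℝ] Rn n))) h hp hg

theorem Frame.coord_act (c : OpenPartialHomeomorph M (Rn n)) (X : Frame n M)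
    (g : Rn n ≃L[ℝ] Rn n) :
    (X.act g).coord c = ((X.coord c).1, (X.coord c).2 ∘L (g : Rn n →L[ℝ] Rn n)) := rfl

theorem Frame.std_base (c : OpenPartialHomeomorph M (Rn n)) (x : M) :
    (Frame.std c x).base = x := Frame.mkOf_base _ _

theorem Frame.coord_std {c : OpenPartialHomeomorph M (Rn n)} (h : IsLocalDiffeo (n := n) c)
    {x : M} (hx : x ∈ c.source) :
    (Frame.std c x).coord c = (c x, ContinuousLinearMap.id ℝ (Rn n)) := by
  have hT := h.isInvertible hx
  have e : Frame.std c x = ⟨x, _, hT.inverse⟩ := Frame.mkOf_eq hT.inverse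
  rw [e]
  exact Prod.ext rfl hT.self_comp_inverse

theorem IsLocalDiffeo.isCoordSystem [IsManifold 𝓘(ℝ, Rn n) ∞ M]
    {c : OpenPartialHomeomorph M (Rn n)} (h : IsLocalDiffeo (n := n) c) : IsCoordSystem c :=
  c.mem_maximalAtlas_of_contMDiffOn h.smooth h.smooth_symm

theorem isCoordSystem_refl (n : ℕ) : IsCoordSystem (OpenPartialHomeomorph.refl (Rn n)) :=
  StructureGroupoid.id_mem_maximalAtlas _

end FrameMaps

/-! ### Jets are determined by their coordinates -/

section Jets

variable {n : ℕ} {M N P : Type*}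
  [TopologicalSpace M] [ChartedSpace (Rn n) M]
  [TopologicalSpace N] [ChartedSpace (Rn n) N]
  [TopologicalSpace P] [ChartedSpace (Rn n) P]
  [IsManifold 𝓘(ℝ, Rn n) ∞ M] [IsManifold 𝓘(ℝ, Rn n) ∞ N] [IsManifold 𝓘(ℝ, Rn n) ∞ P]

open LocalFrameIso

theorem Jet.ofDiffeo_comp {φ : OpenPartialHomeomorph M N} (h : IsLocalDiffeo (n := n) φ)
    {χ : OpenPartialHomeomorph N P} (h' : IsLocalDiffeo (n := n) χ) {x : M} {y : N} {z : P}
    (hx : x ∈ φ.source) (hy : φ x = y) (hy' : y ∈ χ.source) (hz : χ y = z) :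
    (Jet.ofDiffeo φ h hx hy).comp (Jet.ofDiffeo χ h' hy' hz) =
      Jet.ofDiffeo (φ.trans χ) (h.trans h') (x := x) (y := z)
        (by subst hy; exact ⟨hx, hy'⟩) (by subst hy; exact hz) := by
  subst hy
  refine Quotient.sound (s := jetSetoid n x z) (sameJetAt_of_eqOn
    ((φ.trans χ).open_source.mem_nhds ⟨hx, hy'⟩) fun X hX => ?_)
  exact Frame.map_map h h' hX.1 hX.2

theorem Jet.ofDiffeo_congr {φ χ : OpenPartialHomeomorph M N} (h : IsLocalDiffeo (n := n) φ)
    (h' : IsLocalDiffeo (n := n) χ) {x : M} {y : N} (hx : x ∈ φ.source) (hy : φ x = y)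
    (hx' : x ∈ χ.source) (hy' : χ x = y) (e : φ =ᶠ[𝓝 x] χ) :
    Jet.ofDiffeo φ h hx hy = Jet.ofDiffeo χ h' hx' hy' := by
  obtain ⟨s, hs, hso, hxs⟩ := mem_nhds_iff.1 e
  refine Jet.mk_eq_mk.2 (sameJetAt_of_eqOn (hso.mem_nhds hxs) fun X hX => ?_)
  exact Frame.map_congr (Filter.mem_of_superset (hso.mem_nhds hX) hs)

/-- The coordinate expression of a local isomorphism of frame bundles, near a frame over `x`, is
determined by equivariance from its values at the frames `e₁`. -/
theorem LocalFrameIso.rep_eventuallyEq (Ψ : LocalFrameIso n M N)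
    {c : OpenPartialHomeomorph M (Rn n)} (hc : IsCoordSystem c)
    (c' : OpenPartialHomeomorph N (Rn n)) {X : Frame n M}
    (hX : X.base ∈ c.source) (hX' : X.base ∈ Ψ.base.source) :
    Ψ.rep c c' =ᶠ[𝓝 (X.coord c)] fun p =>
      ((Ψ.rep c c' (p.1, ContinuousLinearMap.id ℝ (Rn n))).1,
        (Ψ.rep c c' (p.1, ContinuousLinearMap.id ℝ (Rn n))).2 ∘L p.2) := by
  filter_upwards [eventually_base hX (Ψ.base.open_source.mem_nhds hX'),
    eventually_valid hc hX] with p hp hp2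
  obtain ⟨g, hg⟩ := hp2.2
  have h1 := Frame.ofCoord_comp c hc.isLocalDiffeo (p := (p.1, ContinuousLinearMap.id ℝ (Rn n)))
    hp2.1 ⟨ContinuousLinearEquiv.refl ℝ (Rn n), rfl⟩ g
  have h2 : (p.1, ContinuousLinearMap.id ℝ (Rn n) ∘L (g : Rn n →L[ℝ] Rn n)) = p := by
    rw [hg]; rfl
  rw [h2] at h1
  have h3 : (Frame.ofCoord c (p.1, ContinuousLinearMap.id ℝ (Rn n))).base ∈ Ψ.base.source := by
    rw [Frame.base_ofCoord] at hp ⊢; exact hp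
  change (Ψ.toFun (Frame.ofCoord c p)).coord c' = _
  rw [h1, Ψ.equivariant _ h3, Frame.coord_act, hg]
  rfl

/-- The value and the derivative, at the coordinates of `x`, of the expression of `Ψ` along the
frames `e₁` are given by the coordinates of its jet. -/
theorem LocalFrameIso.hasFDerivAt_rep_std (Ψ : LocalFrameIso n M N)
    {c : OpenPartialHomeomorph M (Rn n)} (hc : IsCoordSystem c)
    {c' : OpenPartialHomeomorph N (Rn n)} (hc' : IsCoordSystem c') {x : M}
    (hx : x ∈ c.source) (hx' : x ∈ Ψ.base.source) (hy : Ψ.base x ∈ c'.source) :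
    Ψ.rep c c' (c x, ContinuousLinearMap.id ℝ (Rn n)) = (c' (Ψ.base x), (Ψ.jetCoord c c' x).1) ∧
    HasFDerivAt (fun u => Ψ.rep c c' (u, ContinuousLinearMap.id ℝ (Rn n)))
      ((Ψ.jetCoord c c' x).2.1.prod (Ψ.jetCoord c c' x).2.2) (c x) := by
  have hb := Frame.std_base c x
  have hs := Frame.coord_std hc.isLocalDiffeo hx
  have hd := Ψ.differentiableAt_rep hc hc' (X := Frame.std c x) (by rwa [hb]) (by rwa [hb])
    (by rwa [hb])
  have hr := Ψ.rep_coord hc c' (X := Frame.std c x) (by rwa [hb])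
  constructor
  · rw [← hs, hr]
    refine Prod.ext ?_ rfl
    change c' (Ψ.toFun (Frame.std c x)).base = _
    rw [Ψ.base_toFun _ (by rwa [hb]), hb]
  · have h1 : HasFDerivAt (fun u : Rn n => (u, ContinuousLinearMap.id ℝ (Rn n)))
        (ContinuousLinearMap.inl ℝ (Rn n) (Rn n →L[ℝ] Rn n)) (c x) :=
      hasFDerivAt_prodMk_left _ _
    have h2 := hd.hasFDerivAt
    rw [hs] at h2
    have h3 := h2.comp (c x) h1
    rw [← hs] at h3
    exact h3

/-- The jets of two local isomorphisms of frame bundles with the same jet coordinates agree. -/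
theorem LocalFrameIso.sameJetAt_of_jetCoord_eq {Ψ Φ : LocalFrameIso n M N} {x : M}
    (hxΨ : x ∈ Ψ.base.source) (hxΦ : x ∈ Φ.base.source) (hb : Ψ.base x = Φ.base x)
    {c : OpenPartialHomeomorph M (Rn n)} (hc : IsCoordSystem c)
    {c' : OpenPartialHomeomorph N (Rn n)} (hc' : IsCoordSystem c')
    (hx : x ∈ c.source) (hy : Ψ.base x ∈ c'.source)
    (h : Ψ.jetCoord c c' x = Φ.jetCoord c c' x) : SameJetAt x Ψ Φ := by
  rintro X rfl
  obtain ⟨v1, d1⟩ := Ψ.hasFDerivAt_rep_std hc hc' hx hxΨ hy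
  obtain ⟨v2, d2⟩ := Φ.hasFDerivAt_rep_std hc hc' hx hxΦ (hb ▸ hy)
  have e1 := Ψ.rep_eventuallyEq hc c' hx hxΨ
  have e2 := Φ.rep_eventuallyEq hc c' hx hxΦ
  have v12 := v1.trans ((by rw [hb, h] : _ = _).trans v2.symm)
  have hval : Ψ.toFun X = Φ.toFun X := by
    refine Frame.coord_injOn hc'.isLocalDiffeo ?_ ?_ ?_
    · rw [Ψ.base_toFun X hxΨ]; exact hy
    · rw [Φ.base_toFun X hxΦ, ← hb]; exact hy
    · rw [← Ψ.rep_coord hc c' hx, ← Φ.rep_coord hc c' hx, e1.eq_of_nhds, e2.eq_of_nhds]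
      change (_, _) = (_, _)
      rw [show (X.coord c).1 = c X.base from rfl, v12]
  -- both expressions have the same derivative in the charts `c`, `c'`
  have hder : fderiv ℝ (Ψ.rep c c') (X.coord c) = fderiv ℝ (Φ.rep c c') (X.coord c) := by
    rw [e1.fderiv_eq, e2.fderiv_eq]
    have key : ∀ Θ : LocalFrameIso n M N, ∀ D : Rn n →L[ℝ] FrameCoord n,
        HasFDerivAt (fun u => Θ.rep c c' (u, ContinuousLinearMap.id ℝ (Rn n))) D (c X.base) →
        fderiv ℝ (fun p : FrameCoord n =>
          ((Θ.rep c c' (p.1, ContinuousLinearMap.id ℝ (Rn n))).1,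
          (Θ.rep c c' (p.1, ContinuousLinearMap.id ℝ (Rn n))).2 ∘L p.2)) (X.coord c) = _ :=
      fun Θ D hD => by
        have h1 : HasFDerivAt
            (fun p : FrameCoord n => Θ.rep c c' (p.1, ContinuousLinearMap.id ℝ (Rn n)))
            (D ∘L ContinuousLinearMap.fst ℝ _ _) (X.coord c) :=
          HasFDerivAt.comp (f := Prod.fst) (X.coord c) hD hasFDerivAt_fst
        exact (h1.fst.prodMk (h1.snd.clm_comp hasFDerivAt_snd)).fderiv
    rw [key Ψ _ d1, key Φ _ (h ▸ d2)]
    rw [show (X.coord c).1 = c X.base from rfl, v12]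
  refine ⟨hval, fun a a' ha ha' hxa hya => ?_⟩
  -- the other charts are reached by composing with the identity maps
  let I : LocalFrameIso n M M :=
    LocalFrameIso.ofDiffeo (OpenPartialHomeomorph.refl M) IsLocalDiffeo.refl
  let J : LocalFrameIso n N N :=
    LocalFrameIso.ofDiffeo (OpenPartialHomeomorph.refl N) IsLocalDiffeo.refl
  have hI : ∀ Y, I.toFun Y = Y := Jet.refl_toFun
  have hJ : ∀ Y, J.toFun Y = Y := Jet.refl_toFun
  have hch : ∀ Θ : LocalFrameIso n M N, X.base ∈ Θ.base.source → Θ.base X.base = Ψ.base X.base →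
      fderiv ℝ (Θ.rep a a') (X.coord a) =
        (fderiv ℝ (J.rep c' a') ((Θ.toFun X).coord c') ∘L fderiv ℝ (Θ.rep c c') (X.coord c)) ∘L
          fderiv ℝ (I.rep a c) (X.coord a) := fun Θ hΘ hΘb => by
    have hyc' : Θ.base X.base ∈ c'.source := by rw [hΘb]; exact hy
    have hya' : Θ.base X.base ∈ a'.source := by
      rw [hΘb, ← Ψ.base_toFun X hxΨ]; exact hya
    have hrefl : Θ.rep a a' = (I.trans (Θ.trans J)).rep a a' := by
      funext p
      change (Θ.toFun _).coord a' = (J.toFun (Θ.toFun (I.toFun _))).coord a'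
      rw [hI, hJ]
    have e1 := fderiv_rep_trans I (Θ.trans J) ha hc ha' (X := X) (mem_univ _) hxa hx
      ⟨hΘ, mem_univ _⟩ hya'
    rw [hI, fderiv_rep_trans Θ J hc hc' ha' hΘ hx hyc' (mem_univ _) hya', ← hrefl] at e1
    exact e1
  rw [hch Ψ hxΨ rfl, hch Φ hxΦ hb.symm, hval, hder]

/-- A jet is determined by its coordinates. -/
theorem Jet.coord_injective {x : M} {y : N} {c : OpenPartialHomeomorph M (Rn n)}
    (hc : IsCoordSystem c) {c' : OpenPartialHomeomorph N (Rn n)} (hc' : IsCoordSystem c')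
    (hx : x ∈ c.source) (hy : y ∈ c'.source) :
    Function.Injective (Jet.coord c c' : Jet n x y → JetCoord n) := by
  intro j k h
  obtain ⟨Ψ, hΨ, hΨy, rfl⟩ := j.exists_rep
  obtain ⟨Φ, hΦ, hΦy, rfl⟩ := k.exists_rep
  rw [Jet.coord_mk Ψ hΨ hΨy hc hc' hx hy, Jet.coord_mk Φ hΦ hΦy hc hc' hx hy] at h
  exact Jet.mk_eq_mk.2 (sameJetAt_of_jetCoord_eq hΨ hΦ (hΨy.trans hΦy.symm) hc hc' hx
    (by rwa [hΨy]) h)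

end Jets

/-! ### Translations and jet coordinates -/

section Translations

variable {n : ℕ} {M N P : Type*}
  [TopologicalSpace M] [ChartedSpace (Rn n) M]
  [TopologicalSpace N] [ChartedSpace (Rn n) N]
  [TopologicalSpace P] [ChartedSpace (Rn n) P]
  [IsManifold 𝓘(ℝ, Rn n) ∞ M] [IsManifold 𝓘(ℝ, Rn n) ∞ N] [IsManifold 𝓘(ℝ, Rn n) ∞ P]

open LocalFrameIso

/-- Composing on the right with a diffeomorphism that reads as a translation in the charts does not
change the jet coordinates. -/
theorem LocalFrameIso.jetCoord_ofDiffeo_trans {φ : OpenPartialHomeomorph M N}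
    (h : IsLocalDiffeo (n := n) φ) (Ψ : LocalFrameIso n N P)
    {b : OpenPartialHomeomorph M (Rn n)} (hb : IsCoordSystem b)
    {c : OpenPartialHomeomorph N (Rn n)} (hc : IsCoordSystem c)
    (c' : OpenPartialHomeomorph P (Rn n)) {x : M} (hx : x ∈ φ.source) (hxb : x ∈ b.source)
    (hxc : φ x ∈ c.source) {v : Rn n} (hv : ∀ᶠ u in 𝓝 x, c (φ u) = b u + v) :
    ((LocalFrameIso.ofDiffeo φ h).trans Ψ).jetCoord b c' x = Ψ.jetCoord c c' (φ x) := by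
  have hs := Frame.coord_std hb.isLocalDiffeo hxb
  have hs' := Frame.coord_std hc.isLocalDiffeo hxc
  have hmap : ∀ X : Frame n M, X.base ∈ φ.source → X.base ∈ b.source → φ X.base ∈ c.source →
      (∀ᶠ u in 𝓝 X.base, c (φ u) = b u + v) → (X.map φ).coord c = X.coord b + (v, 0) :=
    fun X h1 h2 h3 h4 => by
      rw [Frame.coord_map_of_translation h hb.isLocalDiffeo hc.isLocalDiffeo h1 h2 h3 h4]
      exact Prod.ext rfl (add_zero _).symm
  have hbase := Frame.std_base b x
  have hstd : (Frame.std b x).map φ = Frame.std c (φ x) := by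
    refine Frame.coord_injOn hc.isLocalDiffeo (by simpa [hbase]) (by rwa [Frame.std_base]) ?_
    rw [hmap _ (by rwa [hbase]) (by rwa [hbase]) (by rwa [hbase]) (by rwa [hbase]), hs, hs',
      hv.self_of_nhds]
    exact Prod.ext rfl (add_zero _)
  have hrep : ((LocalFrameIso.ofDiffeo φ h).trans Ψ).rep b c' =ᶠ[𝓝 ((Frame.std b x).coord b)]
      fun p => Ψ.rep c c' (p + (v, 0)) := by
    have hn : {u | u ∈ φ.source ∧ φ u ∈ c.source ∧ ∀ᶠ w in 𝓝 u, c (φ w) = b w + v} ∈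
        𝓝 (Frame.std b x).base := by
      rw [hbase]
      filter_upwards [(φ.isOpen_inter_preimage c.open_source).mem_nhds ⟨hx, hxc⟩,
        hv.eventually_nhds] with u hu hu'
      exact ⟨hu.1, hu.2, hu'⟩
    filter_upwards [eventually_base (by rwa [hbase]) hn,
      eventually_valid hb (X := Frame.std b x) (by rwa [hbase])] with p hp hp'
    have e := hmap (Frame.ofCoord b p) hp.1
      (by rw [Frame.base_ofCoord]; exact b.map_target hp'.1) hp.2.1 hp.2.2
    rw [Frame.coord_ofCoord hb.isLocalDiffeo hp'.1 hp'.2] at e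
    change (Ψ.toFun ((Frame.ofCoord b p).map φ)).coord c' = _
    rw [← e, LocalFrameIso.rep, Frame.ofCoord_coord hc.isLocalDiffeo (by simpa using hp.2.1)]
  have hder : fderiv ℝ (((LocalFrameIso.ofDiffeo φ h).trans Ψ).rep b c')
      ((Frame.std b x).coord b) = fderiv ℝ (Ψ.rep c c') ((Frame.std c (φ x)).coord c) := by
    rw [hrep.fderiv_eq, fderiv_comp_add_right, ← hstd,
      hmap _ (by rwa [hbase]) (by rwa [hbase]) (by rwa [hbase]) (by rwa [hbase])]
  have hval : ((LocalFrameIso.ofDiffeo φ h).trans Ψ).toFun (Frame.std b x) =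
      Ψ.toFun (Frame.std c (φ x)) := congrArg Ψ.toFun hstd
  simp only [jetCoord, hder, hval]

/-- Composing on the left with a diffeomorphism that reads as a translation in the charts does not
change the jet coordinates. -/
theorem LocalFrameIso.jetCoord_trans_ofDiffeo {φ : OpenPartialHomeomorph N P}
    (h : IsLocalDiffeo (n := n) φ) (Ψ : LocalFrameIso n M N)
    {c : OpenPartialHomeomorph M (Rn n)}
    {c' : OpenPartialHomeomorph N (Rn n)} (hc' : IsCoordSystem c')
    {b : OpenPartialHomeomorph P (Rn n)} (hb : IsCoordSystem b) {x : M}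
    (hx : x ∈ Ψ.base.source) (hxc : x ∈ c.source) (hy : Ψ.base x ∈ φ.source)
    (hyc : Ψ.base x ∈ c'.source) (hyb : φ (Ψ.base x) ∈ b.source)
    {v : Rn n} (hv : ∀ᶠ u in 𝓝 (Ψ.base x), b (φ u) = c' u + v) :
    (Ψ.trans (LocalFrameIso.ofDiffeo φ h)).jetCoord c b x = Ψ.jetCoord c c' x := by
  have hbase := Frame.std_base c x
  -- near `x`, the two coordinate expressions differ by a constant
  have hcoord : ∀ X : Frame n M, X.base ∈ Ψ.base.source → Ψ.base X.base ∈ φ.source →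
      Ψ.base X.base ∈ c'.source → φ (Ψ.base X.base) ∈ b.source →
      (∀ᶠ u in 𝓝 (Ψ.base X.base), b (φ u) = c' u + v) →
      ((Ψ.trans (LocalFrameIso.ofDiffeo φ h)).toFun X).coord b =
        (Ψ.toFun X).coord c' + (v, 0) := fun X h0 h1 h2 h3 h4 => by
    have hX := Ψ.base_toFun X h0
    refine (Frame.coord_map_of_translation (X := Ψ.toFun X) h hc'.isLocalDiffeo hb.isLocalDiffeo
      (by rwa [hX]) (by rwa [hX]) (by rwa [hX]) (by rwa [hX])).trans ?_
    exact Prod.ext rfl (add_zero _).symm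
  have hrep : (Ψ.trans (LocalFrameIso.ofDiffeo φ h)).rep c b =ᶠ[𝓝 ((Frame.std c x).coord c)]
      fun p => Ψ.rep c c' p + (v, 0) := by
    have hn : {u | u ∈ Ψ.base.source ∧ Ψ.base u ∈ φ.source ∧ Ψ.base u ∈ c'.source ∧
        φ (Ψ.base u) ∈ b.source ∧ ∀ᶠ w in 𝓝 (Ψ.base u), b (φ w) = c' w + v} ∈
        𝓝 (Frame.std c x).base := by
      rw [hbase]
      have hcont : Filter.Tendsto Ψ.base (𝓝 x) (𝓝 (Ψ.base x)) := Ψ.base.continuousAt hx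
      filter_upwards [Ψ.base.open_source.mem_nhds hx,
        hcont ((φ.isOpen_inter_preimage b.open_source).mem_nhds ⟨hy, hyb⟩),
        hcont (c'.open_source.mem_nhds hyc), hcont.eventually hv.eventually_nhds]
        with u h1 h2 h3 h4
      exact ⟨h1, h2.1, h3, h2.2, h4⟩
    filter_upwards [eventually_base (by rwa [hbase]) hn] with p hp
    exact hcoord _ hp.1 hp.2.1 hp.2.2.1 hp.2.2.2.1 hp.2.2.2.2
  have hder : fderiv ℝ ((Ψ.trans (LocalFrameIso.ofDiffeo φ h)).rep c b)
      ((Frame.std c x).coord c) = fderiv ℝ (Ψ.rep c c') ((Frame.std c x).coord c) := by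
    rw [hrep.fderiv_eq, fderiv_add_const]
  have hval := hcoord (Frame.std c x) (by rwa [hbase]) (by rwa [hbase]) (by rwa [hbase])
    (by rwa [hbase]) (by rwa [hbase])
  simp only [jetCoord, hder, hval, Prod.snd_add, add_zero]

/-- The jet of the identity has the coordinates `(δ, δ, 0)`. -/
theorem Jet.coord_refl {c : OpenPartialHomeomorph M (Rn n)} (hc : IsCoordSystem c) {x : M}
    (hx : x ∈ c.source) : (Jet.refl n x).coord c c =
      (ContinuousLinearMap.id ℝ (Rn n), ContinuousLinearMap.id ℝ (Rn n), 0) := by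
  have hbase := Frame.std_base c x
  let I : LocalFrameIso n M M :=
    LocalFrameIso.ofDiffeo (OpenPartialHomeomorph.refl M) IsLocalDiffeo.refl
  refine (Jet.coord_mk I (mem_univ x) rfl hc hc hx hx).trans ?_
  have hrep : I.rep c c =ᶠ[𝓝 ((Frame.std c x).coord c)] id := by
    filter_upwards [eventually_valid hc (X := Frame.std c x) (by rwa [hbase])] with p hp
    change ((Frame.ofCoord c p).map _).coord c = p
    rw [Jet.refl_toFun, Frame.coord_ofCoord hc.isLocalDiffeo hp.1 hp.2]
  have hval : I.toFun (Frame.std c x) = Frame.std c x := Jet.refl_toFun _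
  have hder : fderiv ℝ (I.rep c c) ((Frame.std c x).coord c) =
      ContinuousLinearMap.id ℝ (FrameCoord n) := by rw [hrep.fderiv_eq, fderiv_id]
  rw [Frame.coord_std hc.isLocalDiffeo hx] at hder
  simp only [jetCoord, hval, Frame.coord_std hc.isLocalDiffeo hx, hder]
  rfl

theorem jetFromOrigin_comp_jetToOrigin (c : OpenPartialHomeomorph M (Rn n)) (hc : IsCoordSystem c)
    {x : M} (hx : x ∈ c.source) :
    (jetFromOrigin c hc x hx).comp (jetToOrigin c hc x hx) = Jet.refl n (0 : Rn n) := by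
  refine (Jet.ofDiffeo_comp _ _ _ _ _ _).trans (Jet.ofDiffeo_congr _ _ _ _ _ _ ?_)
  have h : ∀ᶠ u in 𝓝 (0 : Rn n), u + c x ∈ c.target :=
    (continuous_id.add continuous_const).continuousAt.eventually_mem
      (by simpa using c.open_target.mem_nhds (c.map_source hx))
  filter_upwards [h] with u hu
  simp [translation, c.right_inv hu]

/-- The jet at `x` of the diffeomorphism that reads as the translation by `c(y) - c(x)`. -/
theorem jetToOrigin_comp_jetFromOrigin (c : OpenPartialHomeomorph M (Rn n)) (hc : IsCoordSystem c)
    {x y : M} (hx : x ∈ c.source) (hy : y ∈ c.source) {v : Rn n} (hv : c x + v = c y)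
    (hx' : x ∈ (c.trans ((translation v).trans c.symm)).source)
    (hy' : c.trans ((translation v).trans c.symm) x = y) :
    (jetToOrigin c hc x hx).comp (jetFromOrigin c hc y hy) =
      Jet.ofDiffeo (c.trans ((translation v).trans c.symm))
        (hc.isLocalDiffeo.trans ((translation_isLocalDiffeo v).trans hc.isLocalDiffeo.symm))
        hx' hy' := by
  refine (Jet.ofDiffeo_comp _ _ _ _ _ _).trans (Jet.ofDiffeo_congr _ _ _ _ _ _ ?_)
  refine Filter.Eventually.of_forall fun u => ?_
  obtain rfl : v = c y - c x := by rw [← hv]; abel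
  simp only [translation, OpenPartialHomeomorph.coe_trans, Function.comp_apply,
    Homeomorph.toOpenPartialHomeomorph_apply, Homeomorph.coe_addRight]
  congr 1
  abel

theorem jetToOrigin_comp_jetFromOrigin_self (c : OpenPartialHomeomorph M (Rn n))
    (hc : IsCoordSystem c) {x : M} (hx : x ∈ c.source) :
    (jetToOrigin c hc x hx).comp (jetFromOrigin c hc x hx) = Jet.refl n x := by
  refine (jetToOrigin_comp_jetFromOrigin c hc hx hx (v := 0) (by simp) (by simp [translation, hx])
    (by simp [translation, hx])).trans (Jet.ofDiffeo_congr _ _ _ _ _ _ ?_)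
  filter_upwards [c.open_source.mem_nhds hx] with u hu
  simp [translation, hu]

end Translations

/-! ### Coordinates of the transported jets -/

section LocalIsotropy

variable {n : ℕ} {M : Type*} [TopologicalSpace M] [ChartedSpace (Rn n) M]
  [IsManifold 𝓘(ℝ, Rn n) ∞ M]

/-- In coordinates, the map `toTrivial` is the identity: conjugating by translations does not change the
jet coordinates. -/
theorem coord_localIsotropy {c : OpenPartialHomeomorph M (Rn n)} (hc : IsCoordSystem c)
    {x y : JetObj n M} (hx : (x : M) ∈ c.source) (hy : (y : M) ∈ c.source) (j : x ⟶ y) :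
    G2.coord (localIsotropy c hc hx hy j) = homCoord c c j := by
  obtain ⟨Ψ, hΨ, hΨy, hj⟩ := Jet.exists_rep (M := M) (N := M) (x := x) (y := y) j
  subst hj
  have hr := isCoordSystem_refl n
  let φ := (translation (c x)).trans c.symm
  let χ := c.trans (translation (-c y))
  have hφ : IsLocalDiffeo (n := n) φ :=
    (translation_isLocalDiffeo (c x)).trans hc.isLocalDiffeo.symm
  have hχ : IsLocalDiffeo (n := n) χ := hc.isLocalDiffeo.trans (translation_isLocalDiffeo _)
  have e0 : φ (0 : Rn n) = x := by
    simpa [φ, translation] using c.left_inv hx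
  have h0 : (0 : Rn n) ∈ φ.source := by
    simpa [φ, translation] using c.map_source hx
  have ey : χ y = (0 : Rn n) := add_neg_cancel (c y)
  have hyχ : y ∈ χ.source := by simp [χ, translation, hy]
  let A : LocalFrameIso n (Rn n) M := LocalFrameIso.ofDiffeo φ hφ
  let B : LocalFrameIso n M (Rn n) := LocalFrameIso.ofDiffeo χ hχ
  have hA : (0 : Rn n) ∈ A.base.source := h0
  have hA' : A.base (0 : Rn n) = x := e0
  have hB : y ∈ B.base.source := hyχ
  have hB' : B.base y = (0 : Rn n) := ey
  refine (Jet.coord_mk (A.trans (Ψ.trans B))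
    (LocalFrameIso.mem_source_trans hA hA' (LocalFrameIso.mem_source_trans hΨ hΨy hB))
    (LocalFrameIso.base_trans_apply hA' (LocalFrameIso.base_trans_apply hΨy hB'))
    hr hr (mem_univ _) (mem_univ _)).trans ?_
  refine Eq.trans ?_ (Jet.coord_mk Ψ hΨ hΨy hc hc hx hy).symm
  have h1 := LocalFrameIso.jetCoord_ofDiffeo_trans hφ (Ψ.trans B) hr hc
    (OpenPartialHomeomorph.refl (Rn n)) h0 (mem_univ _) (by rw [e0]; exact hx) (v := c x) (by
      filter_upwards [φ.open_source.mem_nhds h0] with u hu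
      exact c.right_inv hu.2)
  refine h1.trans ?_
  rw [e0]
  subst hΨy
  exact LocalFrameIso.jetCoord_trans_ofDiffeo _ Ψ hc hr hΨ hx hyχ
    hy (mem_univ _) (v := -c (Ψ.base x)) (Filter.Eventually.of_forall fun u => rfl)

theorem G2.coord_injective : Function.Injective (G2.coord (n := n)) :=
  Jet.coord_injective (M := Rn n) (N := Rn n) (isCoordSystem_refl n) (isCoordSystem_refl n)
    (mem_univ _) (mem_univ _)

theorem G2.coord_one : G2.coord (1 : G2 n) =
    (ContinuousLinearMap.id ℝ (Rn n), ContinuousLinearMap.id ℝ (Rn n), 0) :=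
  Jet.coord_refl (M := Rn n) (isCoordSystem_refl n) (mem_univ _)

end LocalIsotropy

/-! ### Embedded submanifolds -/

section Submanifolds

variable {V W : Type*} [NormedAddCommGroup V] [NormedSpace ℝ V]
  [NormedAddCommGroup W] [NormedSpace ℝ W]

theorem isEmbeddedSubmanifold_singleton [FiniteDimensional ℝ V] (p : V) :
    IsEmbeddedSubmanifold ({p} : Set V) := by
  intro p' hp'
  obtain rfl : p' = p := hp'
  refine ⟨_, fun q => toEuclidean (q - p'), univ, isOpen_univ, mem_univ _,
    ((toEuclidean (E := V)).contDiff.comp (contDiff_id.sub contDiff_const)).contDiffOn, ?_, ?_⟩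
  · have h : HasFDerivAt (fun q => toEuclidean (q - p'))
        ((toEuclidean (E := V) : V →L[ℝ] _) ∘L ContinuousLinearMap.id ℝ V) p' :=
      HasFDerivAt.comp (f := fun q => q - p') p' (toEuclidean (E := V)).hasFDerivAt
        ((hasFDerivAt_id p').sub_const p')
    rw [h.fderiv]
    exact (toEuclidean (E := V)).surjective
  · ext q
    simp [sub_eq_zero]

/-- If `U × K` is an embedded submanifold, with `U` open and nonempty, then so is the slice `K`: the
local equations of `U × K` are constant along `U`, hence remain submersions on the slice. -/
theorem IsEmbeddedSubmanifold.of_prod {U : Set V} (hU : IsOpen U) (hne : U.Nonempty) {K : Set W}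
    (h : IsEmbeddedSubmanifold (U ×ˢ K)) : IsEmbeddedSubmanifold K := by
  intro w hw
  obtain ⟨u, hu⟩ := hne
  obtain ⟨k, f, O, hO, hp, hf, hsurj, hS⟩ := h (u, w) ⟨hu, hw⟩
  have hzero : ∀ q ∈ O, q ∈ U ×ˢ K ↔ f q = 0 := fun q hq =>
    ⟨fun hq' => ((hS ▸ ⟨hq', hq⟩ : q ∈ {q ∈ O | f q = 0})).2,
      fun hq' => (hS.symm ▸ (⟨hq, hq'⟩ : q ∈ {q ∈ O | f q = 0}) : q ∈ U ×ˢ K ∩ O).1⟩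
  have hd : HasFDerivAt f (fderiv ℝ f (u, w)) (u, w) :=
    ((hf.contDiffAt (hO.mem_nhds hp)).differentiableAt (by simp)).hasFDerivAt
  have h1 : HasFDerivAt (fun v => f (v, w)) _ u := hd.comp u (hasFDerivAt_prodMk_left u w)
  have h2 : HasFDerivAt (fun v => f (u, v)) _ w := hd.comp w (hasFDerivAt_prodMk_right u w)
  -- all points `(v, w)` with `v` near `u` are in `U × K`
  have h0 : (fun v => f (v, w)) =ᶠ[𝓝 u] fun _ => 0 := by
    have hc : ContinuousAt (fun v : V => (v, w)) u := by fun_prop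
    filter_upwards [hU.mem_nhds hu, hc (hO.mem_nhds hp)] with v hv hv'
    exact (hzero _ hv').1 ⟨hv, hw⟩
  have h3 := h1.unique ((hasFDerivAt_const 0 u).congr_of_eventuallyEq h0)
  have hcont : Continuous fun v : W => (u, v) := by fun_prop
  refine ⟨k, fun v => f (u, v), (fun v => (u, v)) ⁻¹' O, hO.preimage hcont, hp,
    hf.comp (contDiff_prodMk_right u).contDiffOn (fun v hv => hv), ?_, ?_⟩
  · intro e
    obtain ⟨⟨a, b⟩, hab⟩ := hsurj e
    refine ⟨b, ?_⟩
    rw [h2.fderiv, ← hab]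
    have h4 := DFunLike.congr_fun h3 a
    simp only [ContinuousLinearMap.comp_apply, ContinuousLinearMap.inl_apply,
      zero_apply] at h4
    have h5 : ((a, b) : V × W) = (a, 0) + (0, b) := by simp
    rw [h5, map_add, h4, zero_add]
    rfl
  · ext v
    constructor
    · rintro ⟨hv, hv'⟩
      exact ⟨hv', (hzero _ hv').1 ⟨hu, hv⟩⟩
    · rintro ⟨hv, hv'⟩
      exact ⟨((hzero _ hv).2 hv').2, hv⟩

end Submanifolds

set_option synthInstance.maxHeartbeats 200000 in
theorem isEmbeddedSubmanifold_singleton_jetCoord {n : ℕ} (p : JetCoord n) :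
    IsEmbeddedSubmanifold ({p} : Set (JetCoord n)) := by
  have h1 : FiniteDimensional ℝ (Rn n →L[ℝ] Rn n) := inferInstance
  have h2 : FiniteDimensional ℝ (Rn n →L[ℝ] Rn n →L[ℝ] Rn n) := inferInstance
  exact isEmbeddedSubmanifold_singleton p

/-! ### Composition of jets -/

section JetAlgebra

variable {n : ℕ} {M N P Q R S : Type*}
  [TopologicalSpace M] [ChartedSpace (Rn n) M] [IsManifold 𝓘(ℝ, Rn n) ∞ M]
  [TopologicalSpace N] [ChartedSpace (Rn n) N] [IsManifold 𝓘(ℝ, Rn n) ∞ N]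
  [TopologicalSpace P] [ChartedSpace (Rn n) P] [IsManifold 𝓘(ℝ, Rn n) ∞ P]
  [TopologicalSpace Q] [ChartedSpace (Rn n) Q] [IsManifold 𝓘(ℝ, Rn n) ∞ Q]
  [TopologicalSpace R] [ChartedSpace (Rn n) R] [IsManifold 𝓘(ℝ, Rn n) ∞ R]
  [TopologicalSpace S] [ChartedSpace (Rn n) S] [IsManifold 𝓘(ℝ, Rn n) ∞ S]

theorem Jet.conj_comp_conj {o : M} {x : N} {y : P} {o' : Q} {z : R} {o'' : S} (a : Jet n o x)
    (j : Jet n x y) {b : Jet n y o'} {b' : Jet n o' y} (k : Jet n y z) (d : Jet n z o'')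
    (h : b.comp b' = Jet.refl n y) :
    (a.comp (j.comp b)).comp (b'.comp (k.comp d)) = a.comp ((j.comp k).comp d) := by
  rw [Jet.comp_assoc a, Jet.comp_assoc j b, ← Jet.comp_assoc b b', h, Jet.refl_comp,
    Jet.comp_assoc j k]

theorem Jet.conj_conj {o : M} {x : N} {o' : P} {y : Q} {a : Jet n o x} {a' : Jet n x o}
    (g : Jet n o o') {b' : Jet n o' y} {b : Jet n y o'} (ha : a.comp a' = Jet.refl n o)
    (hb : b'.comp b = Jet.refl n o') : a.comp ((a'.comp (g.comp b')).comp b) = g := by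
  rw [Jet.comp_assoc a', Jet.comp_assoc g, hb, Jet.comp_refl, ← Jet.comp_assoc a, ha,
    Jet.refl_comp]

theorem Jet.comp_comp_inv_comp {o : M} {x : N} {x' : P} {y : Q} {y' : R} {o' : S} (a : Jet n o x)
    (t : Jet n x x') (j : Jet n x y) (s : Jet n y y') (b : Jet n y' o') :
    (a.comp t).comp ((t.inv.comp (j.comp s)).comp b) = a.comp (j.comp (s.comp b)) := by
  rw [Jet.comp_assoc a t, Jet.comp_assoc t.inv, ← Jet.comp_assoc t t.inv, Jet.comp_inv,
    Jet.refl_comp, Jet.comp_assoc j s]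

end JetAlgebra

/-! ### Adapted coordinate systems -/

section Adapted

variable {n : ℕ} {M : Type*} [TopologicalSpace M] [ChartedSpace (Rn n) M]
  [IsManifold 𝓘(ℝ, Rn n) ∞ M]

theorem localIsotropy_comp {c : OpenPartialHomeomorph M (Rn n)} (hc : IsCoordSystem c)
    {x y z : JetObj n M} (hx : (x : M) ∈ c.source) (hy : (y : M) ∈ c.source)
    (hz : (z : M) ∈ c.source) (j : x ⟶ y) (k : y ⟶ z) :
    localIsotropy c hc hx hz (j ≫ k) =
      localIsotropy c hc hx hy j ≫ localIsotropy c hc hy hz k := by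
  exact (Jet.conj_comp_conj (M := Rn n) (N := M) (P := M) (Q := Rn n) (R := M) (S := Rn n)
    _ _ _ _ (jetToOrigin_comp_jetFromOrigin_self c hc hy)).symm

theorem localIsotropy_injective {c : OpenPartialHomeomorph M (Rn n)} (hc : IsCoordSystem c)
    {x y : JetObj n M} (hx : (x : M) ∈ c.source) (hy : (y : M) ∈ c.source) :
    Function.Injective (localIsotropy c hc hx hy) := by
  intro j k h
  have h' := congrArg G2.coord h
  rw [coord_localIsotropy, coord_localIsotropy] at h'
  exact Jet.coord_injective (M := M) (N := M) hc hc hx hy h'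

theorem localIsotropy_surjective {c : OpenPartialHomeomorph M (Rn n)} (hc : IsCoordSystem c)
    {x y : JetObj n M} (hx : (x : M) ∈ c.source) (hy : (y : M) ∈ c.source) :
    Function.Surjective (localIsotropy c hc hx hy) := by
  intro g
  exact ⟨_, Jet.conj_conj (M := Rn n) (N := M) (P := Rn n) (Q := M) g
    (jetFromOrigin_comp_jetToOrigin c hc hx) (jetFromOrigin_comp_jetToOrigin c hc hy)⟩

/-- The jet `j¹_{x,y} F(c⁻¹ ∘ τ_{c(y)-c(x)} ∘ c)`: the value at `(x, y)` of the flat section of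
`c`. -/
noncomputable def flatJet (c : OpenPartialHomeomorph M (Rn n)) (hc : IsCoordSystem c)
    {x y : JetObj n M} (hx : (x : M) ∈ c.source) (hy : (y : M) ∈ c.source) : x ⟶ y :=
  Jet.comp (M := M) (N := Rn n) (P := M) (jetToOrigin c hc x hx) (jetFromOrigin c hc y hy)

theorem localIsotropy_flatJet {c : OpenPartialHomeomorph M (Rn n)} (hc : IsCoordSystem c)
    {x y : JetObj n M} (hx : (x : M) ∈ c.source) (hy : (y : M) ∈ c.source) :
    localIsotropy c hc hx hy (flatJet c hc hx hy) = 1 := by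
  have h := Jet.conj_conj (M := Rn n) (N := M) (P := Rn n) (Q := M) (Jet.refl n (0 : Rn n))
    (jetFromOrigin_comp_jetToOrigin c hc hx) (jetFromOrigin_comp_jetToOrigin c hc hy)
  have h' := congrArg (fun k => (jetFromOrigin c hc x hx).comp
    (((jetToOrigin c hc x hx).comp k).comp (jetToOrigin c hc y hy)))
    (Jet.refl_comp (M := Rn n) (N := M) (jetFromOrigin c hc y hy))
  exact h'.symm.trans h

/-- The coordinates `(δ, δ, 0)` characterize the jets `flatJet`. -/
theorem homCoord_eq_iff {c : OpenPartialHomeomorph M (Rn n)} (hc : IsCoordSystem c)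
    {x y : JetObj n M} (hx : (x : M) ∈ c.source) (hy : (y : M) ∈ c.source) (j : x ⟶ y) :
    homCoord c c j = (ContinuousLinearMap.id ℝ (Rn n), ContinuousLinearMap.id ℝ (Rn n), 0) ↔
      j = flatJet c hc hx hy := by
  rw [← coord_localIsotropy hc hx hy, ← G2.coord_one, G2.coord_injective.eq_iff,
    ← localIsotropy_flatJet hc hx hy, (localIsotropy_injective hc hx hy).eq_iff]

theorem FlatSectionIn.flatJet_mem {Γ : Subgroupoid (JetObj n M)}
    {c : OpenPartialHomeomorph M (Rn n)} (h : FlatSectionIn Γ c) (hc : IsCoordSystem c)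
    {x y : JetObj n M} (hx : (x : M) ∈ c.source) (hy : (y : M) ∈ c.source) :
    flatJet c hc hx hy ∈ Γ.arrows x y := by
  obtain ⟨j, hj, hj'⟩ := h x y hx hy
  rwa [← (homCoord_eq_iff hc hx hy j).1 hj']

/-- A coordinate system `c` is adapted to the subgroup `G` of `G̅²(n)` if the map `toTrivial`
of `c` carries `Γ`, over the domain `U` of `c`, to the trivial groupoid of group `G`. -/
def IsAdapted (Γ : Subgroupoid (JetObj n M)) (G : Subgroup (G2 n))
    (c : OpenPartialHomeomorph M (Rn n)) (hc : IsCoordSystem c) : Prop :=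
  ∀ (x y : JetObj n M) (hx : (x : M) ∈ c.source) (hy : (y : M) ∈ c.source) (j : x ⟶ y),
    j ∈ Γ.arrows x y ↔ localIsotropy c hc hx hy j ∈ G

theorem toTrivial_of_mem {c : OpenPartialHomeomorph M (Rn n)} (hc : IsCoordSystem c)
    {a : Arrow n M} (hx : (a.src : M) ∈ c.source) (hy : (a.tgt : M) ∈ c.source) :
    toTrivial c hc a = (c (a.src : M), c (a.tgt : M), localIsotropy c hc hx hy a.jet) := by
  unfold toTrivial
  rw [dif_pos ⟨hx, hy⟩]

theorem trivialCoord_toTrivial {c : OpenPartialHomeomorph M (Rn n)} (hc : IsCoordSystem c)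
    {a : Arrow n M} (hx : (a.src : M) ∈ c.source) (hy : (a.tgt : M) ∈ c.source) :
    trivialCoord (toTrivial c hc a) = Arrow.coord c c a := by
  rw [toTrivial_of_mem hc hx hy, trivialCoord, coord_localIsotropy]
  rfl

theorem IsAdapted.bijOn {Γ : Subgroupoid (JetObj n M)} {G : Subgroup (G2 n)}
    {c : OpenPartialHomeomorph M (Rn n)} {hc : IsCoordSystem c} (h : IsAdapted Γ G c hc) :
    BijOn (toTrivial c hc) (arrowsOver Γ c.source c.source) (trivialOver G c) := by
  refine ⟨?_, ?_, ?_⟩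
  · rintro a ⟨hx, hy, ha⟩
    rw [toTrivial_of_mem hc hx hy]
    exact ⟨c.map_source hx, c.map_source hy, (h _ _ hx hy _).1 ha⟩
  · rintro ⟨x, y, j⟩ ⟨hx, hy, -⟩ ⟨x', y', k⟩ ⟨hx', hy', -⟩ e
    rw [toTrivial_of_mem hc hx hy, toTrivial_of_mem hc hx' hy'] at e
    have hxx : x = x' := c.injOn hx hx' (congrArg Prod.fst e)
    have hyy : y = y' := c.injOn hy hy' (congrArg (fun p => p.2.1) e)
    subst hxx hyy
    have hjk : j = k := localIsotropy_injective hc hx hy (congrArg (fun p => p.2.2) e)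
    subst hjk
    rfl
  · rintro ⟨u, v, g⟩ ⟨hu, hv, hg⟩
    obtain ⟨j, hj⟩ := localIsotropy_surjective hc (x := c.symm u) (y := c.symm v)
      (c.map_target hu) (c.map_target hv) g
    refine ⟨⟨c.symm u, c.symm v, j⟩, ⟨c.map_target hu, c.map_target hv,
      (h _ _ (c.map_target hu) (c.map_target hv) j).2 (hj ▸ hg)⟩, ?_⟩
    rw [toTrivial_of_mem hc (c.map_target hu) (c.map_target hv)]
    exact Prod.ext (c.right_inv hu) (Prod.ext (c.right_inv hv) hj)

/-- An adapted coordinate system induces an isomorphism of Lie groupoids; in coordinates, this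
isomorphism is the identity. -/
theorem IsAdapted.inducesIso {Γ : Subgroupoid (JetObj n M)} {G : Subgroup (G2 n)}
    {c : OpenPartialHomeomorph M (Rn n)} {hc : IsCoordSystem c} (h : IsAdapted Γ G c hc)
    (hne : Nonempty M) : InducesIso Γ G c hc where
  bijOn := h.bijOn
  map_comp _ _ _ hx hy hz j _ k _ := localIsotropy_comp hc hx hy hz j k
  smooth := ⟨id, contDiffOn_id, fun _ ha => trivialCoord_toTrivial hc ha.1 ha.2.1⟩
  smooth_inv := by
    obtain ⟨x⟩ := hne
    have : Nonempty (Arrow n M) := ⟨⟨x, x, 𝟙 (show JetObj n M from x)⟩⟩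
    refine ⟨_, h.bijOn.invOn_invFunOn, id, contDiffOn_id, fun p hp => ?_⟩
    have hm := h.bijOn.surjOn.mapsTo_invFunOn hp
    rw [← trivialCoord_toTrivial hc hm.1 hm.2.1, h.bijOn.invOn_invFunOn.2 hp]
    rfl

theorem IsAdapted.image_coord {Γ : Subgroupoid (JetObj n M)} {G : Subgroup (G2 n)}
    {c : OpenPartialHomeomorph M (Rn n)} {hc : IsCoordSystem c} (h : IsAdapted Γ G c hc) :
    Arrow.coord c c '' arrowsOver Γ c.source c.source =
      c.target ×ˢ (c.target ×ˢ (G2.coord '' (G : Set (G2 n)))) := by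
  have h1 : Arrow.coord c c '' arrowsOver Γ c.source c.source =
      trivialCoord '' (toTrivial c hc '' arrowsOver Γ c.source c.source) := by
    rw [image_image]
    exact image_congr fun a ha => (trivialCoord_toTrivial hc ha.1 ha.2.1).symm
  rw [h1, h.bijOn.image_eq]
  ext ⟨u, v, w⟩
  constructor
  · rintro ⟨⟨u, v, g⟩, ⟨hu, hv, hg⟩, e⟩
    cases e
    exact ⟨hu, hv, g, hg, rfl⟩
  · rintro ⟨hu, hv, g, hg, rfl⟩
    exact ⟨(u, v, g), ⟨hu, hv, hg⟩, rfl⟩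

theorem IsAdapted.isLieSubgroup {Γ : Subgroupoid (JetObj n M)} (hΓ : IsReducedLieSubgroupoid Γ)
    {G : Subgroup (G2 n)} {c : OpenPartialHomeomorph M (Rn n)} {hc : IsCoordSystem c}
    (h : IsAdapted Γ G c hc) (hne : c.source.Nonempty) : IsLieSubgroup G := by
  have hne' : c.target.Nonempty := hne.imp' c fun x hx => c.map_source hx
  have hS := hΓ.embedded c c hc hc
  rw [h.image_coord] at hS
  exact (hS.of_prod c.open_target hne').of_prod c.open_target hne'

/-- If the flat section of `c` takes values in `Γ`, then `c` is adapted to the isotropy group of `Γ`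
at any point of its domain, transported to the origin. -/
theorem FlatSectionIn.exists_isAdapted {Γ : Subgroupoid (JetObj n M)}
    {c : OpenPartialHomeomorph M (Rn n)} (h : FlatSectionIn Γ c) (hc : IsCoordSystem c)
    (hne : c.source.Nonempty) : ∃ G : Subgroup (G2 n), IsAdapted Γ G c hc := by
  obtain ⟨z, hz⟩ := hne
  let z' : JetObj n M := z
  have hz' : (z' : M) ∈ c.source := hz
  have hobj : z' ∈ Γ.objs := Γ.mem_objs_of_src (h.flatJet_mem hc hz' hz')
  refine ⟨(Γ.vertexSubgroup hobj).map (MonoidHom.mk' (localIsotropy c hc hz' hz')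
    fun j k => localIsotropy_comp hc hz' hz' hz' j k), fun x y hx hy j => ?_⟩
  have hxz := h.flatJet_mem hc hz' hx
  have hyz := h.flatJet_mem hc hy hz'
  -- moving `j` to `z` along flat jets does not change its image in `G̅²(n)`
  have hj : localIsotropy c hc hz' hz' (flatJet c hc hz' hx ≫ j ≫ flatJet c hc hy hz') =
      localIsotropy c hc hx hy j := by
    rw [localIsotropy_comp hc hz' hx hz', localIsotropy_comp hc hx hy hz',
      localIsotropy_flatJet, localIsotropy_flatJet]
    exact (one_mul _).trans (mul_one _)
  rw [← hj, ← Γ.mul_mem_cancel_right hyz, ← Γ.mul_mem_cancel_left hxz]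
  constructor
  · exact fun hm => ⟨_, hm, rfl⟩
  · rintro ⟨k, hk, e⟩
    rwa [← localIsotropy_injective hc hz' hz' e]

theorem jetToOrigin_trans {T : OpenPartialHomeomorph M M} (hT : IsLocalDiffeo (n := n) T)
    {c : OpenPartialHomeomorph M (Rn n)} (hc : IsCoordSystem c) (hTc : IsCoordSystem (T.trans c))
    {x : M} (hx : x ∈ (T.trans c).source) :
    jetToOrigin (T.trans c) hTc x hx =
      (Jet.ofDiffeo T hT hx.1 rfl).comp (jetToOrigin c hc (T x) hx.2) := by
  refine Eq.symm ((Jet.ofDiffeo_comp hT (hc.isLocalDiffeo.trans (translation_isLocalDiffeo _))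
    hx.1 rfl _ _).trans ?_)
  have e : (T.trans (c.trans (translation (-c (T x)))) : M → Rn n) =ᶠ[𝓝 x]
      (T.trans c).trans (translation (-(T.trans c) x)) := Filter.EventuallyEq.rfl
  exact Jet.ofDiffeo_congr _ _ _ _ _ _ e

theorem jetFromOrigin_trans_comp {T : OpenPartialHomeomorph M M} (hT : IsLocalDiffeo (n := n) T)
    {c : OpenPartialHomeomorph M (Rn n)} (hc : IsCoordSystem c) (hTc : IsCoordSystem (T.trans c))
    {x : M} (hx : x ∈ (T.trans c).source) :
    (jetFromOrigin (T.trans c) hTc x hx).comp (Jet.ofDiffeo T hT hx.1 rfl) =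
      jetFromOrigin c hc (T x) hx.2 := by
  refine (Jet.ofDiffeo_comp _ _ _ _ _ _).trans (Jet.ofDiffeo_congr _ _ _ _ _ _ ?_)
  have h0 : ∀ᶠ u in 𝓝 (0 : Rn n), u + c (T x) ∈ (T.trans c).target :=
    (continuous_id.add continuous_const).continuousAt.eventually_mem
      (by simpa using (T.trans c).open_target.mem_nhds ((T.trans c).map_source hx))
  filter_upwards [h0] with u hu
  exact T.right_inv hu.2

/-- The coordinate systems `c ∘ T` and `c` send an arrow and its conjugate by the jets of `T` to the
same element of `G̅²(n)`. -/
theorem localIsotropy_trans {T : OpenPartialHomeomorph M M} (hT : IsLocalDiffeo (n := n) T)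
    {c : OpenPartialHomeomorph M (Rn n)} (hc : IsCoordSystem c) (hTc : IsCoordSystem (T.trans c))
    {x y : JetObj n M} (hx : (x : M) ∈ (T.trans c).source) (hy : (y : M) ∈ (T.trans c).source)
    (j : x ⟶ y) (t : x ⟶ (T x : JetObj n M)) (s : y ⟶ (T y : JetObj n M))
    (ht : t = Jet.ofDiffeo T hT hx.1 rfl) (hs : s = Jet.ofDiffeo T hT hy.1 rfl) :
    localIsotropy (T.trans c) hTc hx hy j =
      localIsotropy c hc (x := T x) (y := T y) hx.2 hy.2 (Groupoid.inv t ≫ j ≫ s) := by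
  subst ht hs
  unfold localIsotropy
  rw [jetToOrigin_trans hT hc hTc hy, ← jetFromOrigin_trans_comp hT hc hTc hx]
  exact (Jet.comp_comp_inv_comp (M := Rn n) (N := M) (P := M) (Q := M) (R := M) (S := Rn n)
    _ _ j _ _).symm

/-- A local diffeomorphism `T` of `M` all of whose jets are in `Γ` pulls adapted coordinate systems
back to adapted ones. -/
theorem IsAdapted.trans {Γ : Subgroupoid (JetObj n M)} {G : Subgroup (G2 n)}
    {c : OpenPartialHomeomorph M (Rn n)} {hc : IsCoordSystem c} (h : IsAdapted Γ G c hc)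
    {T : OpenPartialHomeomorph M M} (hT : IsLocalDiffeo (n := n) T)
    (hΓ : ∀ (x : M) (hx : x ∈ T.source),
      Jet.ofDiffeo T hT hx rfl ∈ Γ.arrows (x : JetObj n M) (T x : JetObj n M))
    (hTc : IsCoordSystem (T.trans c)) : IsAdapted Γ G (T.trans c) hTc := by
  intro x y hx hy j
  let t : x ⟶ (T x : JetObj n M) := Jet.ofDiffeo T hT hx.1 rfl
  let s : y ⟶ (T y : JetObj n M) := Jet.ofDiffeo T hT hy.1 rfl
  have ht : t ∈ Γ.arrows _ _ := hΓ x hx.1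
  have hs : s ∈ Γ.arrows _ _ := hΓ y hy.1
  have hj := localIsotropy_trans hT hc hTc hx hy j t s rfl rfl
  rw [hj]
  refine Iff.trans ?_ (h (T x) (T y) hx.2 hy.2 _)
  exact ((Γ.mul_mem_cancel_left (Γ.inv ht)).trans (Γ.mul_mem_cancel_right hs)).symm

/-- If the flat section of `c` takes values in `Γ`, and one point of the domain of `c` has a
coordinate system adapted to `G`, then so does any other: the translations in the coordinates `c`
have their jets in `Γ`, and move adapted coordinate systems around. -/
theorem FlatSectionIn.exists_isAdapted_of_mem {Γ : Subgroupoid (JetObj n M)}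
    {c : OpenPartialHomeomorph M (Rn n)} (h : FlatSectionIn Γ c) (hc : IsCoordSystem c)
    {G : Subgroup (G2 n)} {x y : M} (hx : x ∈ c.source) (hy : y ∈ c.source)
    (hG : ∃ (e : OpenPartialHomeomorph M (Rn n)) (he : IsCoordSystem e),
      y ∈ e.source ∧ IsAdapted Γ G e he) :
    ∃ (e : OpenPartialHomeomorph M (Rn n)) (he : IsCoordSystem e),
      x ∈ e.source ∧ IsAdapted Γ G e he := by
  obtain ⟨e, he, hye, hG⟩ := hG
  let v : Rn n := c y - c x
  let T : OpenPartialHomeomorph M M := c.trans ((translation v).trans c.symm)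
  have hT : IsLocalDiffeo (n := n) T :=
    hc.isLocalDiffeo.trans ((translation_isLocalDiffeo v).trans hc.isLocalDiffeo.symm)
  have hxv : c x + v = c y := by simp [v]
  have hTx : T x = y := by
    change c.symm (c x + v) = y
    rw [hxv, c.left_inv hy]
  have hxT : x ∈ T.source := by
    refine ⟨hx, mem_univ _, ?_⟩
    change c x + v ∈ c.target
    rw [hxv]
    exact c.map_source hy
  have hTe : IsCoordSystem (T.trans e) := (hT.trans he.isLocalDiffeo).isCoordSystem
  refine ⟨T.trans e, hTe, ⟨hxT, by change T x ∈ e.source; rwa [hTx]⟩,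
    hG.trans hT (fun z hz => ?_) hTe⟩
  have hTz : c z + v ∈ c.target := hz.2.2
  have e1 : Jet.ofDiffeo T hT hz rfl =
      flatJet c hc (x := z) (y := T z) hz.1 (c.map_target hTz) :=
    (jetToOrigin_comp_jetFromOrigin c hc hz.1 (c.map_target hTz) (c.right_inv hTz).symm
      hz rfl).symm
  rw [e1]
  exact h.flatJet_mem hc _ _

/-- An isomorphism with a trivial groupoid carries the flat section to the section
`(u, v) ↦ (u, v, 1)`. -/
theorem InducesIso.flatSectionIn {Γ : Subgroupoid (JetObj n M)} {G : Subgroup (G2 n)}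
    {c : OpenPartialHomeomorph M (Rn n)} {hc : IsCoordSystem c} (h : InducesIso Γ G c hc) :
    FlatSectionIn Γ c := by
  intro x y hx hy
  obtain ⟨⟨x', y', j⟩, ⟨hx', hy', hj⟩, e⟩ := h.bijOn.surjOn
    (show (c x, c y, (1 : G2 n)) ∈ trivialOver G c from
      ⟨c.map_source hx, c.map_source hy, G.one_mem⟩)
  rw [toTrivial_of_mem hc hx' hy'] at e
  obtain rfl : x' = x := c.injOn hx' hx (congrArg Prod.fst e)
  obtain rfl : y' = y := c.injOn hy' hy (congrArg (fun p => p.2.1) e)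
  refine ⟨j, hj, ?_⟩
  rw [← coord_localIsotropy hc hx hy, ← G2.coord_one]
  exact congrArg (fun p => G2.coord p.2.2) e

/-- On a connected manifold, flat sections with values in `Γ` yield coordinate systems adapted to
one and the same group around all points. -/
theorem exists_isAdapted_of_flatSectionIn [PreconnectedSpace M] {Γ : Subgroupoid (JetObj n M)}
    (h : ∀ x : M, ∃ c : OpenPartialHomeomorph M (Rn n),
      IsCoordSystem c ∧ x ∈ c.source ∧ FlatSectionIn Γ c) [Nonempty M] :
    ∃ G : Subgroup (G2 n), ∀ x : M, ∃ (e : OpenPartialHomeomorph M (Rn n))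
      (he : IsCoordSystem e), x ∈ e.source ∧ IsAdapted Γ G e he := by
  obtain ⟨x₀⟩ := ‹Nonempty M›
  obtain ⟨c₀, hc₀, hx₀, hΓ₀⟩ := h x₀
  obtain ⟨G, hG⟩ := hΓ₀.exists_isAdapted hc₀ ⟨x₀, hx₀⟩
  let S : Set M := {x | ∃ (e : OpenPartialHomeomorph M (Rn n)) (he : IsCoordSystem e),
    x ∈ e.source ∧ IsAdapted Γ G e he}
  have hS : IsClopen S := by
    constructor
    · -- the complement is open: a flat domain that meets `S` lies in `S`
      refine ⟨isOpen_iff_mem_nhds.2 fun x hx => ?_⟩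
      obtain ⟨c, hc, hxc, hf⟩ := h x
      filter_upwards [c.open_source.mem_nhds hxc] with y hy hyS
      exact hx (hf.exists_isAdapted_of_mem hc hxc hy hyS)
    · refine isOpen_iff_mem_nhds.2 fun x ⟨e, he, hxe, hG⟩ => ?_
      filter_upwards [e.open_source.mem_nhds hxe] with y hy
      exact ⟨e, he, hy, hG⟩
  have hu : S = univ := hS.eq_univ ⟨x₀, c₀, hc₀, hx₀, hG⟩
  exact ⟨G, fun x => (hu ▸ mem_univ x : x ∈ S)⟩

end Adapted

end NonHolonomic

theorem mainTheorem11 {n : ℕ} {M : Type*} [TopologicalSpace M]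
    [ChartedSpace (NonHolonomic.Rn n) M] [IsManifold 𝓘(ℝ, NonHolonomic.Rn n) ∞ M]
    [PreconnectedSpace M]
    (Γ : CategoryTheory.Subgroupoid (NonHolonomic.JetObj n M))
    (hΓ : NonHolonomic.IsReducedLieSubgroupoid Γ) :
    NonHolonomic.IsIntegrable Γ ↔
      ∀ x : M, ∃ c : OpenPartialHomeomorph M (NonHolonomic.Rn n),
        NonHolonomic.IsCoordSystem c ∧ x ∈ c.source ∧ NonHolonomic.FlatSectionIn Γ c := by
  constructor
  · rintro ⟨G, -, h⟩ x
    obtain ⟨c, hc, hx, hiso⟩ := h x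
    exact ⟨c, hc, hx, hiso.flatSectionIn⟩
  · intro h
    rcases isEmpty_or_nonempty M with hM | hM
    · -- without points, any Lie subgroup will do
      refine ⟨⊥, ?_, fun x => hM.elim x⟩
      unfold NonHolonomic.IsLieSubgroup
      rw [Subgroup.coe_bot, Set.image_singleton]
      exact NonHolonomic.isEmbeddedSubmanifold_singleton_jetCoord _
    · obtain ⟨G, hG⟩ := NonHolonomic.exists_isAdapted_of_flatSectionIn h
      refine ⟨G, ?_, fun x => ?_⟩
      · obtain ⟨e, he, hx, ha⟩ := hG hM.some
        exact ha.isLieSubgroup hΓ ⟨_, hx⟩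
      · obtain ⟨e, he, hx, ha⟩ := hG x
        exact ⟨e, he, hx, ha.inducesIso hM⟩
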